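/- **Setting.** A game arena $\mathcal G=(P,V,(V_p)_{p\in P},v_0,E)$ has finite sets $P$ of players and $V$ of vertices, a partition $(V_p)_{p\in P}$ of $V$ (parts may be empty), $v_0\in V$ and $E\subseteq V\times V$, such that every vertex reachable from $v_0$ has an outgoing edge. A play is an infinite $E$-path from $v_0$; a history is a non-empty finite prefix of a play; a strategy of $p$ maps each history ending in a vertex $v\in V_p$ to some $w$ with $(v,w)\in E$; a strategy profile $\sigma$ (one strategy per player) determines its outcome $\mathrm{out}(\sigma)$, a play. Write $\sigma[p\mapsto\tau]$ for $\sigma$ with the strategy of $p$ replaced by $\tau$. For an objective profile $\alpha=(O_p)_{p\in P}$ of sets of plays, $p$ wins under $\sigma$ if $\mathrm{out}(\sigma)\in O_p$; $\sigma$ is a Nash equilibrium if for all $p$ and all strategies $\tau$ of $p$, if $p$ wins under $\sigma[p\mapsto\tau]$ then $p$ wins under $\sigma$. $\mathrm{Winnable}^p$ is the set of all $O$ for which $p$ has a strategy all of whose consistent plays lie in $O$. $\mathrm{Inf}(\rho)$ is the set of vertices occurring infinitely often in $\rho$, and $\mathrm{Muller}(\mathcal F)=\{\rho\mid \mathrm{Inf}(\rho)\in\mathcal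 F\}$ for $\mathcal F\subseteq 2^V$. Let $\Omega$ be the class of all Büchi, all co-Büchi, all parity (the largest color seen infinitely often is even), all Rabin, all Streett or all Muller objectives, and let $\mathit{knw}\in\{\mathsf{pw},\mathsf{gw},\mathsf{pg},\mathsf{pgw}\}$. The objectives in $\Omega$ are sets of plays, except that for $\mathit{knw}=\mathsf{pw}$ they are formed among all infinite strings over $V$. Let $\mathrm{Obj}^{p}_{\mathit{knw}}(\sigma)$ be the set of all $O\in\Omega$ such that * ($\mathsf{pw}$) $\mathrm{out}(\sigma)\in O$ and $p$ wins, or $\mathrm{out}(\sigma)\notin O$ and $p$ does not win; * ($\mathsf{gw}$) $p$ wins and $O\ne\varnothing$, or $p$ does not win and $O\notin\mathrm{Winnable}^p$; * ($\mathsf{pg}$) $\mathrm{out}(\sigma)\in O$, or $\mathrm{out}(\sigma)\notin O$ and $O\notin\mathrm{Winnable}^p$; * ($\mathsf{pgw}$) $\mathrm{out}(\sigma)\in O$ and $p$ wins, or $\mathrm{out}(\sigma)\notin O$ and $p$ does not win and $O\notin\mathrm{Winnable}^p$. The profile $\sigma$ is an objective-indistinguishability equilibrium (OIE) if $\mathrm{Obj}^{p}_{\mathit{knw}}(\sigma[p\mapsto\tau])\subseteq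 \mathrm{Obj}^{p}_{\mathit{knw}}(\sigma)$ for all $p$ and all strategies $\tau$ of $p$. It is an objective-indistinguishability Nash equilibrium (OINE) if it is both an OIE and a Nash equilibrium. **Theorem.** For each $\mathit{knw}$ and each of the six classes $\Omega$, the following problem is decidable: given a game arena $\mathcal G$ and Muller objectives $(\mathrm{Muller}(\mathcal F_p))_{p\in P}$, represented by the families $\mathcal F_p$, is there an OINE? For $\mathit{knw}=\mathsf{pw}$ this also holds when $\Omega$ is replaced by the set of all subsets of $V^\omega$. -/

import Mathlib

/-- A turn-based game arena on the players `P` and the vertices `V`. The partition `(V_p)` of `V`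
is given by the function that sends a vertex to the player controlling it:
`V_p = {v | owner v = p}` (some `V_p` may be empty). -/
structure GameArena (P V : Type*) where
  owner : V → P
  init : V
  edges : Set (V × V)

/-- The set of vertices that occur infinitely often in an infinite string. -/
def infSet {V : Type*} (ρ : ℕ → V) : Set V := {v | ∀ i, ∃ j, i ≤ j ∧ ρ j = v}

/-! ### Objectives

`X` is the set of infinite strings among which the objective is formed: the set of plays of an
arena, or the set of all infinite strings over `V`. -/

def buchi {V : Type*} (X : Set (ℕ → V)) (U : Finset V) : Set (ℕ → V) :=
  {ρ ∈ X | (infSet ρ ∩ ↑U).Nonempty}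

def coBuchi {V : Type*} (X : Set (ℕ → V)) (U : Finset V) : Set (ℕ → V) :=
  {ρ ∈ X | infSet ρ ∩ ↑U = ∅}

/-- The largest color occurring infinitely often is even. -/
def parity {V : Type*} (X : Set (ℕ → V)) (c : V → ℕ) : Set (ℕ → V) :=
  {ρ ∈ X | ∃ v ∈ infSet ρ, (∀ w ∈ infSet ρ, c w ≤ c v) ∧ Even (c v)}

def rabin {V : Type*} (X : Set (ℕ → V)) (L : List (Finset V × Finset V)) : Set (ℕ → V) :=
  {ρ ∈ X | ∃ q ∈ L, infSet ρ ∩ ↑q.1 = ∅ ∧ (infSet ρ ∩ ↑q.2).Nonempty}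

def streett {V : Type*} (X : Set (ℕ → V)) (L : List (Finset V × Finset V)) : Set (ℕ → V) :=
  {ρ ∈ X | ∀ q ∈ L, (infSet ρ ∩ ↑q.1).Nonempty ∨ infSet ρ ∩ ↑q.2 = ∅}

def muller {V : Type*} (X : Set (ℕ → V)) (F : Finset (Finset V)) : Set (ℕ → V) :=
  {ρ ∈ X | ∃ S ∈ F, (↑S : Set V) = infSet ρ}

/-- Names of the classes of objectives. -/
inductive ObjectiveClass
  | buchi | coBuchi | parity | rabin | streett | muller

/-- All objectives of a class, formed among the infinite strings in `X`. -/
def ObjectiveClass.objectives {V : Type*} (C : ObjectiveClass) (X : Set (ℕ → V)) :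
    Set (Set (ℕ → V)) :=
  match C with
  | .buchi => Set.range (_root_.buchi X)
  | .coBuchi => Set.range (_root_.coBuchi X)
  | .parity => Set.range (_root_.parity X)
  | .rabin => Set.range (_root_.rabin X)
  | .streett => Set.range (_root_.streett X)
  | .muller => Set.range (_root_.muller X)

/-- What the adversary knows: the play (`p`), the game arena (`g`), the winners (`w`). -/
inductive Knowledge
  | pw | gw | pg | pgw

namespace GameArena

variable {P V : Type*} (G : GameArena P V)

/-- The infinite strings that start in the initial vertex and follow the edges. -/
def plays : Set (ℕ → V) := {ρ | ρ 0 = G.init ∧ ∀ i, (ρ i, ρ (i + 1)) ∈ G.edges}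

/-- Nonempty finite prefixes of plays. -/
def IsHistory (h : List V) : Prop := ∃ ρ ∈ G.plays, ∃ i, h = (List.range (i + 1)).map ρ

/-- Every vertex reachable from the initial vertex has an outgoing edge. This is exactly what makes
the outcome of every strategy profile an (infinite) play. -/
def NonBlocking : Prop :=
  ∀ v, Relation.ReflTransGen (fun a b => (a, b) ∈ G.edges) G.init v → ∃ w, (v, w) ∈ G.edges

/-- A strategy of player `p`: it maps a history `h ++ [v]` ending in a vertex `v` of `p` to a
successor of `v`. The values of `move` elsewhere are never used. -/
structure Strategy (p : P) where
  move : List V → V → V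
  legal : ∀ h v, G.IsHistory (h ++ [v]) → G.owner v = p → (v, move h v) ∈ G.edges

/-- Strategy profiles. A deviation of `p` to `τ` is `Function.update σ p τ`. -/
abbrev Profile := ∀ p : P, G.Strategy p

variable {G}

/-- The vertices visited before step `i`, and the vertex at step `i`, when everyone plays `σ`. -/
def Profile.run (σ : G.Profile) : ℕ → List V × V
  | 0 => ([], G.init)
  | i + 1 =>
    ((run σ i).1 ++ [(run σ i).2], (σ (G.owner (run σ i).2)).move (run σ i).1 (run σ i).2)

/-- The outcome of a strategy profile. -/
def Profile.out (σ : G.Profile) : ℕ → V := fun i => (σ.run i).2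

/-- The set of plays consistent with a strategy of `p`. -/
def Strategy.outs {p : P} (τ : G.Strategy p) : Set (ℕ → V) :=
  {ρ ∈ G.plays |
    ∀ i, G.owner (ρ i) = p → ρ (i + 1) = τ.move ((List.range i).map ρ) (ρ i)}

variable (G)

/-- The objectives for which `p` has a winning strategy. -/
def winnable (p : P) : Set (Set (ℕ → V)) := {O | ∃ τ : G.Strategy p, τ.outs ⊆ O}

variable {G}

/-- The players that win under `σ`, for the objective profile `α`. -/
def winners (σ : G.Profile) (α : P → Set (ℕ → V)) : Set P := {p | σ.out ∈ α p}

def IsNash [DecidableEq P] (σ : G.Profile) (α : P → Set (ℕ → V)) : Prop :=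
  ∀ (p : P) (τ : G.Strategy p), p ∈ winners (Function.update σ p τ) α → p ∈ winners σ α

/-- The candidate objectives in `Ω` that the adversary cannot exclude as the objective of `p` when
`σ` is played. Of `α` only the objective `α p` of `p` matters. -/
def obj (knw : Knowledge) (Ω : Set (Set (ℕ → V))) (α : P → Set (ℕ → V)) (p : P)
    (σ : G.Profile) : Set (Set (ℕ → V)) :=
  match knw with
  | .pw => {O ∈ Ω | (σ.out ∈ O ∧ p ∈ winners σ α) ∨ (σ.out ∉ O ∧ p ∉ winners σ α)}
  | .gw => {O ∈ Ω | (p ∈ winners σ α ∧ O ≠ ∅) ∨ (p ∉ winners σ α ∧ O ∉ G.winnable p)}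
  | .pg => {O ∈ Ω | σ.out ∈ O ∨ (σ.out ∉ O ∧ O ∉ G.winnable p)}
  | .pgw => {O ∈ Ω | (σ.out ∈ O ∧ p ∈ winners σ α) ∨
      (σ.out ∉ O ∧ p ∉ winners σ α ∧ O ∉ G.winnable p)}

/-- Objective-indistinguishability equilibrium. -/
def IsOIE [DecidableEq P] (knw : Knowledge) (Ω : Set (Set (ℕ → V))) (α : P → Set (ℕ → V))
    (σ : G.Profile) : Prop :=
  ∀ (p : P) (τ : G.Strategy p), obj knw Ω α p (Function.update σ p τ) ⊆ obj knw Ω α p σ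

/-- Objective-indistinguishability Nash equilibrium. -/
def IsOINE [DecidableEq P] (knw : Knowledge) (Ω : Set (Set (ℕ → V))) (α : P → Set (ℕ → V))
    (σ : G.Profile) : Prop :=
  IsOIE knw Ω α σ ∧ IsNash σ α

variable (G)

/-- The candidates of class `C`. An adversary who does not know the arena (`pw`) forms them among
all infinite strings of vertices, otherwise among the plays. -/
def candidates (knw : Knowledge) (C : ObjectiveClass) : Set (Set (ℕ → V)) :=
  match knw with
  | .pw => C.objectives Set.univ
  | .gw => C.objectives G.plays
  | .pg => C.objectives G.plays
  | .pgw => C.objectives G.plays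

end GameArena

/-- Codes of games: the numbers of players and of vertices, the initial vertex, the owner of every
vertex, the adjacency matrix, and for each player the list of the sets of her Muller condition, each
set being written as a bit vector. -/
abbrev GameCode :=
  ℕ × ℕ × ℕ × List ℕ × List (List Bool) × List (List (List Bool))

open Classical in
/-- The code of an arena with Muller conditions `F p`. -/
noncomputable def encodeGame {k n : ℕ} (G : GameArena (Fin k) (Fin n))
    (F : Fin k → List (Finset (Fin n))) : GameCode :=
  (k, n, G.init,
    List.ofFn fun v => (G.owner v : ℕ),
    List.ofFn fun v => List.ofFn fun w => decide ((v, w) ∈ G.edges),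
    List.ofFn fun p => (F p).map fun S => List.ofFn fun v => decide (v ∈ S))

/-- A property of an arena and a profile of objectives is decidable for Muller objectives: there is
an algorithm which, given the code of any arena (with outcomes defined) and of any family of Muller
conditions, one for each player, tells whether the property holds. -/
def DecidableForMullerGames
    (Q : ∀ {k n : ℕ} (_ : GameArena (Fin k) (Fin n)), (Fin k → Set (ℕ → Fin n)) → Prop) : Prop :=
  ∃ f : GameCode → Bool, Computable f ∧
    ∀ (k n : ℕ) (G : GameArena (Fin k) (Fin n)) (F : Fin k → List (Finset (Fin n))),
      G.NonBlocking →
        (f (encodeGame G F) = true ↔ Q G fun p => muller G.plays (F p).toFinset)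

/-!
# Deciding the existence of objective-indistinguishability Nash equilibria

Whether a profile is an equilibrium depends only on the sets of vertices that occur infinitely often
in its outcome and in the outcomes of its deviations: if the former set is `S`, then each deviation
of `p` has to end up in a family `tolerated p S` of sets, which is determined by the candidate
objectives. Hence an equilibrium exists if and only if, for some `S`, there is a play with infinity
set `S` all of whose vertices `v` have the property that, for every `p`, the coalition against `p`
wins the Muller game with winning condition `tolerated p S` from `v`
(`GameArena.exists_profile_iff`, `GameArena.exists_isOINE_iff`): the coalition follows the play and
punishes whoever leaves it first. The existence of plays with a given infinity set and the sets
`winnable p` that enter the definition of `tolerated` are Muller games as well.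

Muller games are solved by McNaughton's recursion on the arena. It is written here as a finite
certificate, a family `T` of sets of vertices each of which is justified by smaller members of `T`
(`MullerGame.Dom`). Certificates yield winning strategies (`MullerGame.Dom.plan`), and every finite
arena splits into a part with a certificate for one player and a part with a certificate for the
other (`MullerGame.determined`), so that certificates describe the winning regions exactly.

A candidate objective is given by the family of infinity sets that satisfy it. The families
definable in a class are described by quantifiers over finite objects
(`ObjectiveClass.mem_objectives_iff`): for Rabin and Streett conditions by the pairs that are sound
for the family, for parity conditions by colorings with at most `2 * n` colors. The criterion thus
only quantifies over vertices, sets of vertices, families of such sets, and colorings. Encoding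
these as natural numbers turns it into bounded quantification, which is primitive recursive
(`Recog.exists`).

When all sets of infinite strings are candidates for an adversary who knows the play and the
winners, no deviation may change the outcome, which means that the play is forced
(`GameArena.exists_isOINE_pw_univ_iff`).
-/

/-! ### The set of vertices visited infinitely often -/

theorem infSet_shift {V : Type*} (ρ : ℕ → V) (i : ℕ) :
    infSet (fun j => ρ (i + j)) = infSet ρ := by
  ext v
  constructor
  · intro h m
    obtain ⟨j, -, rfl⟩ := h m
    obtain ⟨j, hj, hv⟩ := h m
    exact ⟨i + j, by omega, hv⟩
  · intro h m
    obtain ⟨j, hj, rfl⟩ := h (i + m)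
    exact ⟨j - i, by omega, by simp only; congr 1; omega⟩

theorem infSet_subset {V : Type*} {ρ : ℕ → V} {X : Set V} (h : ∀ i, ρ i ∈ X) : infSet ρ ⊆ X := by
  intro v hv
  obtain ⟨j, -, rfl⟩ := hv 0
  exact h j

namespace MullerGame

variable {V : Type} {E : V → V → Prop} {A X Y Z : Set V} {𝒜 : Set (Set V)}

/-! ### Attractors, arenas and traps -/

/-- `B` contains every vertex of the arena `X` from which the player owning `A` can force the next
vertex to be in `B`. -/
def AttrClosed (E : V → V → Prop) (A X B : Set V) : Prop :=
  ∀ x ∈ X, (x ∈ A ∧ ∃ y ∈ X, E x y ∧ y ∈ B) ∨ (x ∉ A ∧ ∀ y ∈ X, E x y → y ∈ B) → x ∈ B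

/-- The attractor of `Z` in the arena `X`: the vertices from which the player owning `A` can force a
visit to `Z`. -/
def attr (E : V → V → Prop) (A X Z : Set V) : Set V :=
  {v | ∀ B, Z ⊆ B → AttrClosed E A X B → v ∈ B}

/-- Every vertex of `X` has a successor in `X`. -/
def IsArena (E : V → V → Prop) (X : Set V) : Prop := ∀ x ∈ X, ∃ y ∈ X, E x y

/-- The player owning `A` cannot leave `Y` in the arena `X`. -/
def IsTrap (E : V → V → Prop) (A X Y : Set V) : Prop := ∀ x ∈ Y, x ∈ A → ∀ y ∈ X, E x y → y ∈ Y

theorem subset_attr : Z ⊆ attr E A X Z := fun _ hv _ hZ _ => hZ hv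

theorem attrClosed_attr : AttrClosed E A X (attr E A X Z) := by
  intro x hx h B hZ hB
  refine hB x hx ?_
  rcases h with ⟨hA, y, hy, hxy, hyB⟩ | ⟨hA, h⟩
  · exact Or.inl ⟨hA, y, hy, hxy, hyB B hZ hB⟩
  · exact Or.inr ⟨hA, fun y hy hxy => h y hy hxy B hZ hB⟩

theorem attr_subset (h : Z ⊆ X) : attr E A X Z ⊆ X := fun _ hv => hv X h fun _ hx _ => hx

/-- The vertices from which the player owning `A` can force a visit to `Z` within `n` steps. -/
def stage (E : V → V → Prop) (A X Z : Set V) : ℕ → Set V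
  | 0 => Z
  | n + 1 => Z ∪ {x ∈ X | (x ∈ A ∧ ∃ y ∈ X, E x y ∧ y ∈ stage E A X Z n) ∨
      (x ∉ A ∧ ∀ y ∈ X, E x y → y ∈ stage E A X Z n)}

theorem stage_mono : Monotone (stage E A X Z) := by
  refine monotone_nat_of_le_succ fun n => ?_
  induction n with
  | zero => exact Set.subset_union_left
  | succ n ih =>
    refine Set.union_subset_union_right _ ?_
    rintro x ⟨hx, ⟨hA, y, hy, hxy, h⟩ | ⟨hA, h⟩⟩
    · exact ⟨hx, Or.inl ⟨hA, y, hy, hxy, ih h⟩⟩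
    · exact ⟨hx, Or.inr ⟨hA, fun y hy hxy => ih (h y hy hxy)⟩⟩

theorem stage_subset (h : Z ⊆ X) : ∀ n, stage E A X Z n ⊆ X
  | 0 => h
  | _ + 1 => Set.union_subset h fun _ hx => hx.1

theorem exists_mem_stage [Finite V] {v : V} (hv : v ∈ attr E A X Z) :
    ∃ n, v ∈ stage E A X Z n := by
  refine hv {v | ∃ n, v ∈ stage E A X Z n} (fun v hv => ⟨0, hv⟩) ?_
  rintro x hx (⟨hA, y, hy, hxy, n, hn⟩ | ⟨hA, h⟩)
  · exact ⟨n + 1, Or.inr ⟨hx, Or.inl ⟨hA, y, hy, hxy, hn⟩⟩⟩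
  · -- finitely many successors, so one bound on the number of steps serves them all
    have h' : ∀ y, ∃ n, y ∈ X → E x y → y ∈ stage E A X Z n := by
      intro y
      by_cases hy : y ∈ X ∧ E x y
      · obtain ⟨n, hn⟩ := h y hy.1 hy.2
        exact ⟨n, fun _ _ => hn⟩
      · exact ⟨0, fun h1 h2 => absurd ⟨h1, h2⟩ hy⟩
    choose f hf using h'
    obtain ⟨N, hN⟩ := (Set.finite_range f).bddAbove
    exact ⟨N + 1, Or.inr ⟨hx, Or.inr ⟨hA, fun y hy hxy =>
      stage_mono (hN ⟨y, rfl⟩) (hf y hy hxy)⟩⟩⟩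

theorem IsArena.diff_attr (h : IsArena E X) : IsArena E (X \ attr E A X Z) := by
  rintro x ⟨hx, hxa⟩
  by_contra hcon
  have hall : ∀ y ∈ X, E x y → y ∈ attr E A X Z := by
    intro y hy hxy
    by_contra hya
    exact hcon ⟨y, ⟨hy, hya⟩, hxy⟩
  by_cases hA : x ∈ A
  · obtain ⟨y, hy, hxy⟩ := h x hx
    exact hxa (attrClosed_attr x hx (Or.inl ⟨hA, y, hy, hxy, hall y hy hxy⟩))
  · exact hxa (attrClosed_attr x hx (Or.inr ⟨hA, hall⟩))

theorem isTrap_diff_attr : IsTrap E A X (X \ attr E A X Z) := by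
  rintro x ⟨hx, hxa⟩ hA y hy hxy
  exact ⟨hy, fun hya => hxa (attrClosed_attr x hx (Or.inl ⟨hA, y, hy, hxy, hya⟩))⟩

theorem IsTrap.trans (h : IsTrap E A X Y) (h' : IsTrap E A Y Z) (hZ : Z ⊆ Y) : IsTrap E A X Z :=
  fun x hx hA y hy hxy => h' x hx hA y (h x (hZ hx) hA y hy hxy) hxy

/-- The opponent's moves out of the attractor of `Z` start in `Z`. -/
theorem IsTrap.attr (h : IsTrap E Aᶜ X Z) : IsTrap E Aᶜ X (attr E A X Z) := by
  intro x hx hA y hy hxy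
  by_cases hxZ : x ∈ Z
  · exact subset_attr (h x hxZ hA y hy hxy)
  by_contra hyB
  -- otherwise the attractor without `x` would still be closed
  refine (hx (MullerGame.attr E A X Z \ {x})
    (fun z hz => ⟨subset_attr hz, fun h => hxZ (h ▸ hz)⟩) ?_).2 rfl
  intro x' hx' h
  refine ⟨attrClosed_attr x' hx' (h.imp ?_ ?_), ?_⟩
  · rintro ⟨hA', y', hy', hxy', hyB'⟩
    exact ⟨hA', y', hy', hxy', hyB'.1⟩
  · rintro ⟨hA', h⟩
    exact ⟨hA', fun y' hy' hxy' => (h y' hy' hxy').1⟩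
  · rintro rfl
    rcases h with ⟨hA', -⟩ | ⟨-, h⟩
    · exact hA hA'
    · exact hyB (h y hy hxy).1

/-- The attractor does not change when the arena is restricted to a set that contains it. -/
theorem attr_subset_attr (hY : Y ⊆ X) (h : attr E A X Z ⊆ Y) : attr E A X Z ⊆ attr E A Y Z := by
  intro x hx
  refine (hx (attr E A X Z ∩ attr E A Y Z) (fun z hz => ⟨subset_attr hz, subset_attr hz⟩) ?_).2
  intro x' hx' hcon
  have hx'a : x' ∈ attr E A X Z := attrClosed_attr x' hx' (hcon.imp
    (fun ⟨hA, y, hy, hxy, hyB⟩ => ⟨hA, y, hy, hxy, hyB.1⟩)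
    fun ⟨hA, h'⟩ => ⟨hA, fun y hy hxy => (h' y hy hxy).1⟩)
  exact ⟨hx'a, attrClosed_attr x' (h hx'a) (hcon.imp
    (fun ⟨hA, y, hy, hxy, hyB⟩ => ⟨hA, y, h hyB.1, hxy, hyB.2⟩)
    fun ⟨hA, h'⟩ => ⟨hA, fun y hy hxy => (h' y (hY hy) hxy).2⟩)⟩

/-! ### Strategy graphs -/

/-- A nondeterministic winning strategy with arbitrary memory, for the player owning `A`, from every
vertex of `X`, in the game played inside `X` until `Z` is reached: the play has to visit `Z`, or its
set of vertices occurring infinitely often has to be in `𝒜`. The configurations `K` carry a position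
and the memory; `Next` holds the moves that the strategy allows. -/
structure Plan (E : V → V → Prop) (A X Z : Set V) (𝒜 : Set (Set V)) where
  K : Type
  pos : K → V
  Next : K → K → Prop
  pos_mem : ∀ k, pos k ∈ X
  cover : ∀ x ∈ X, ∃ k, pos k = x
  edge : ∀ k k', Next k k' → E (pos k) (pos k')
  own : ∀ k, pos k ∈ A → pos k ∉ Z → ∃ k', Next k k'
  opp : ∀ k, pos k ∉ A → pos k ∉ Z → ∀ y ∈ X, E (pos k) y → ∃ k', Next k k' ∧ pos k' = y
  win : ∀ κ : ℕ → K, (∀ i, Next (κ i) (κ (i + 1))) → (∀ i, pos (κ i) ∉ Z) →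
    infSet (fun i => pos (κ i)) ∈ 𝒜

/-- The empty set is won by the empty graph. -/
def Plan.ofEmpty (h : ∀ x, x ∉ X) : Plan E A X Z 𝒜 where
  K := Empty
  pos := Empty.elim
  Next _ _ := False
  pos_mem k := k.elim
  cover x hx := absurd hx (h x)
  edge k := k.elim
  own k := k.elim
  opp k := k.elim
  win κ := (κ 0).elim

/-- A path that cannot go from the right summand to the left one eventually stays in one of them. -/
theorem sum_path {α β : Type*} (κ : ℕ → α ⊕ β)
    (h : ∀ i a b, κ i = Sum.inr b → κ (i + 1) ≠ Sum.inl a) :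
    (∃ f : ℕ → α, ∀ i, κ i = Sum.inl (f i)) ∨
      ∃ i, ∃ f : ℕ → β, ∀ j, κ (i + j) = Sum.inr (f j) := by
  by_cases hc : ∃ i b, κ i = Sum.inr b
  · right
    obtain ⟨i, b, hb⟩ := hc
    have : ∀ j, ∃ b, κ (i + j) = Sum.inr b := by
      intro j
      induction j with
      | zero => exact ⟨b, hb⟩
      | succ j ih =>
        obtain ⟨b, hb⟩ := ih
        cases hk : κ (i + (j + 1)) with
        | inl a => exact absurd hk (h (i + j) a b hb)
        | inr b' => exact ⟨b', rfl⟩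
    choose f hf using this
    exact ⟨i, f, hf⟩
  · left
    have : ∀ i, ∃ a, κ i = Sum.inl a := by
      intro i
      cases hk : κ i with
      | inl a => exact ⟨a, rfl⟩
      | inr b => exact absurd ⟨i, b, hk⟩ hc
    choose f hf using this
    exact ⟨f, hf⟩

/-- A strategy on `X'` extends to the attractor of `Z`: leaving `X'` means entering the attractor,
where the number of steps to `Z` goes down. -/
theorem Plan.attract [Finite V] {X' : Set V} (P : Plan E A X' ∅ 𝒜) (hX' : X' ⊆ X) (hZ : Z ⊆ X)
    (h : ∀ x ∈ X, x ∈ X' ∨ x ∈ attr E A X Z) : Nonempty (Plan E A X Z 𝒜) := by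
  let Next : P.K ⊕ {q : ℕ × V // q.2 ∈ stage E A X Z q.1} →
      P.K ⊕ {q : ℕ × V // q.2 ∈ stage E A X Z q.1} → Prop
    | .inl k, .inl k' => P.Next k k'
    | .inl k, .inr q => E (P.pos k) q.1.2
    | .inr q, .inr q' => q'.1.1 < q.1.1 ∧ E q.1.2 q'.1.2
    | .inr _, .inl _ => False
  refine ⟨{ K := P.K ⊕ {q : ℕ × V // q.2 ∈ stage E A X Z q.1},
            pos := Sum.elim P.pos fun q => q.1.2, Next := Next,
            pos_mem := ?_, cover := ?_, edge := ?_, own := ?_, opp := ?_, win := ?_ }⟩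
  · rintro (k | ⟨⟨n, x⟩, hx⟩)
    · exact hX' (P.pos_mem k)
    · exact stage_subset hZ n hx
  · intro x hx
    rcases h x hx with hx | hx
    · obtain ⟨k, hk⟩ := P.cover x hx
      exact ⟨.inl k, hk⟩
    · obtain ⟨n, hn⟩ := exists_mem_stage hx
      exact ⟨.inr ⟨(n, x), hn⟩, rfl⟩
  · rintro (k | q) (k' | q') hk
    · exact P.edge k k' hk
    · exact hk
    · exact hk.elim
    · exact hk.2
  · rintro (k | ⟨⟨n, x⟩, hx⟩) hA hZ'
    · obtain ⟨k', hk'⟩ := P.own k hA (Set.notMem_empty _)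
      exact ⟨.inl k', hk'⟩
    · cases n with
      | zero => exact absurd hx hZ'
      | succ n =>
        rcases hx with hx | ⟨hx, ⟨_, y, hy, hxy, hyn⟩ | ⟨hA', _⟩⟩
        · exact absurd hx hZ'
        · exact ⟨.inr ⟨(n, y), hyn⟩, Nat.lt_succ_self n, hxy⟩
        · exact absurd hA hA'
  · rintro (k | ⟨⟨n, x⟩, hx⟩) hA hZ' y hy hxy
    · by_cases hyX : y ∈ X'
      · obtain ⟨k', hk', rfl⟩ := P.opp k hA (Set.notMem_empty _) y hyX hxy
        exact ⟨.inl k', hk', rfl⟩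
      · obtain ⟨n, hn⟩ := exists_mem_stage ((h y hy).resolve_left hyX)
        exact ⟨.inr ⟨(n, y), hn⟩, hxy, rfl⟩
    · cases n with
      | zero => exact absurd hx hZ'
      | succ n =>
        rcases hx with hx | ⟨hx, ⟨hA', _⟩ | ⟨_, hall⟩⟩
        · exact absurd hx hZ'
        · exact absurd hA' hA
        · exact ⟨.inr ⟨(n, y), hall y hy hxy⟩, ⟨Nat.lt_succ_self n, hxy⟩, rfl⟩
  · intro κ hκ _
    have hs : ∀ i a b, κ i = Sum.inr b → κ (i + 1) ≠ Sum.inl a := by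
      intro i a b hb ha
      have := hκ i
      rw [ha, hb] at this
      exact this
    rcases sum_path κ hs with ⟨f, hf⟩ | ⟨i, f, hf⟩
    · have := P.win f (fun i => by have := hκ i; rw [hf, hf] at this; exact this)
        fun _ => Set.notMem_empty _
      simpa only [hf, Sum.elim_inl] using this
    · exfalso
      have hlt : ∀ j, (f (j + 1)).1.1 < (f j).1.1 := by
        intro j
        have := hκ (i + j)
        rw [hf, add_assoc, hf] at this
        exact this.1
      have hle : ∀ j, (f j).1.1 + j ≤ (f 0).1.1 := by
        intro j
        induction j with
        | zero => exact le_rfl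
        | succ j ih => have := hlt j; omega
      have := hle ((f 0).1.1 + 1)
      omega

/-- If from all of `X` every single vertex `u` of `X` can be visited unless the play is won, then
aiming at all the vertices of `X` in turn wins, provided that `X` itself is in `𝒜`. -/
theorem Plan.cycle [Finite V] (hX : X ∈ 𝒜) (hne : X.Nonempty) (harena : IsArena E X)
    (h : ∀ u ∈ X, Nonempty (Plan E A X {u} 𝒜)) : Nonempty (Plan E A X ∅ 𝒜) := by
  obtain ⟨g, hg⟩ := (Set.toFinite X).countable.exists_eq_range hne
  -- a sequence of targets in which each vertex of `X` occurs infinitely often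
  let e : ℕ → V := fun t => g t.unpair.2
  have heX : ∀ t, e t ∈ X := fun t => hg ▸ ⟨_, rfl⟩
  have he : ∀ u ∈ X, ∀ N, ∃ t, N ≤ t ∧ e t = u := by
    intro u hu N
    rw [hg] at hu
    obtain ⟨m, rfl⟩ := hu
    exact ⟨Nat.pair N m, Nat.left_le_pair N m, by simp [e]⟩
  have P : ∀ t, Plan E A X {e t} 𝒜 := fun t => (h (e t) (heX t)).some
  let pos : (Σ t, (P t).K) → V := fun k => (P k.1).pos k.2
  refine ⟨{ K := Σ t, (P t).K, pos := pos,
            Next := fun k k' =>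
              (∃ t a b, k = ⟨t, a⟩ ∧ k' = ⟨t, b⟩ ∧ (P t).Next a b ∧ (P t).pos a ≠ e t) ∨
              (k'.1 = k.1 + 1 ∧ pos k = e k.1 ∧ E (pos k) (pos k')),
            pos_mem := ?_, cover := ?_, edge := ?_, own := ?_, opp := ?_, win := ?_ }⟩
  · exact fun k => (P k.1).pos_mem k.2
  · intro x hx
    obtain ⟨k, hk⟩ := (P 0).cover x hx
    exact ⟨⟨0, k⟩, hk⟩
  · rintro k k' (⟨t, a, b, rfl, rfl, hn, -⟩ | ⟨-, -, hE⟩)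
    · exact (P t).edge a b hn
    · exact hE
  · rintro ⟨t, a⟩ hA -
    by_cases hat : (P t).pos a = e t
    · obtain ⟨y, hy, hxy⟩ := harena _ ((P t).pos_mem a)
      obtain ⟨b, hb⟩ := (P (t + 1)).cover y hy
      exact ⟨⟨t + 1, b⟩, Or.inr ⟨rfl, hat, by simp only [pos, hb]; exact hxy⟩⟩
    · obtain ⟨b, hb⟩ := (P t).own a hA hat
      exact ⟨⟨t, b⟩, Or.inl ⟨t, a, b, rfl, rfl, hb, hat⟩⟩
  · rintro ⟨t, a⟩ hA - y hy hxy
    by_cases hat : (P t).pos a = e t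
    · obtain ⟨b, hb⟩ := (P (t + 1)).cover y hy
      exact ⟨⟨t + 1, b⟩, Or.inr ⟨rfl, hat, by simp only [pos, hb]; exact hxy⟩, hb⟩
    · obtain ⟨b, hb, hby⟩ := (P t).opp a hA hat y hy hxy
      exact ⟨⟨t, b⟩, Or.inl ⟨t, a, b, rfl, rfl, hb, hat⟩, hby⟩
  · intro κ hκ _
    have hstep : ∀ i, ((κ (i + 1)).1 = (κ i).1) ∨
        ((κ (i + 1)).1 = (κ i).1 + 1 ∧ pos (κ i) = e (κ i).1) := by
      intro i
      rcases hκ i with ⟨t, a, b, ha, hb, -, -⟩ | ⟨h1, h2, -⟩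
      · left; rw [ha, hb]
      · exact Or.inr ⟨h1, h2⟩
    have hmono : Monotone fun i => (κ i).1 := by
      refine monotone_nat_of_le_succ fun i => ?_
      rcases hstep i with h | ⟨h, -⟩ <;> omega
    by_cases hinf : ∀ m, ∃ j, m ≤ j ∧ (κ (j + 1)).1 ≠ (κ j).1
    · have hunb : ∀ N, ∃ i, N ≤ (κ i).1 := by
        intro N
        induction N with
        | zero => exact ⟨0, Nat.zero_le _⟩
        | succ N ih =>
          obtain ⟨i, hi⟩ := ih
          obtain ⟨j, hj, hne⟩ := hinf i
          have h1 : (κ i).1 ≤ (κ j).1 := hmono hj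
          have h2 : (κ j).1 ≤ (κ (j + 1)).1 := hmono (Nat.le_succ j)
          exact ⟨j + 1, by omega⟩
      have : infSet (fun i => pos (κ i)) = X := by
        refine (infSet_subset fun i => (P _).pos_mem _).antisymm fun u hu m => ?_
        obtain ⟨T, hT, rfl⟩ := he u hu (κ m).1
        classical
        have hex : ∃ j, T < (κ j).1 := hunb (T + 1)
        have hspec := Nat.find_spec hex
        have hmin := fun j => @Nat.find_min _ _ hex j
        cases hj : Nat.find hex with
        | zero =>
          rw [hj] at hspec
          have : (κ 0).1 ≤ (κ m).1 := hmono (Nat.zero_le m)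
          omega
        | succ j =>
          rw [hj] at hspec
          have hlt := hmin j (by omega)
          rcases hstep j with h | ⟨h, h'⟩
          · omega
          · have hTj : (κ j).1 = T := by omega
            refine ⟨j, ?_, by rw [← hTj]; exact h'⟩
            by_contra hjm
            have : (κ (j + 1)).1 ≤ (κ m).1 := hmono (by omega)
            omega
      rw [this]
      exact hX
    · push Not at hinf
      obtain ⟨m, hm⟩ := hinf
      have hconst : ∀ j, (κ (m + j)).1 = (κ m).1 := by
        intro j
        induction j with
        | zero => rfl
        | succ j ih => rw [← ih]; exact hm (m + j) (by omega)
      have hex : ∀ j, ∃ a : (P (κ m).1).K, κ (m + j) = ⟨(κ m).1, a⟩ := by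
        intro j
        have := hconst j
        revert this
        generalize κ (m + j) = k
        generalize (κ m).1 = t
        rintro rfl
        exact ⟨k.2, rfl⟩
      choose a ha using hex
      rw [← infSet_shift _ m]
      have hna : ∀ j, (P (κ m).1).Next (a j) (a (j + 1)) ∧ (P (κ m).1).pos (a j) ≠ e (κ m).1 := by
        intro j
        have hj := hκ (m + j)
        rw [add_assoc, ha, ha] at hj
        rcases hj with ⟨t, b, c, hb, hc, hn, hne⟩ | ⟨hn, -⟩
        · generalize (κ m).1 = t0 at *
          cases hb
          cases hc
          exact ⟨hn, hne⟩
        · simp at hn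
      have := (P (κ m).1).win a (fun j => (hna j).1) fun j => (hna j).2
      simpa only [ha] using this

/-- To win on `X`, reach the set `Z`, which the opponent cannot leave, and then win there. The union
of the two graphs enters the second one with a move that starts in `Z`. -/
theorem Plan.split (P : Plan E A X Z 𝒜) (Q : Plan E A Z ∅ 𝒜) (hZ : Z ⊆ X)
    (htrap : IsTrap E Aᶜ X Z) : Nonempty (Plan E A X ∅ 𝒜) := by
  let Next : P.K ⊕ Q.K → P.K ⊕ Q.K → Prop
    | .inl k, .inl k' => P.pos k ∉ Z ∧ P.Next k k'
    | .inl k, .inr q' => ∃ q, Q.pos q = P.pos k ∧ Q.Next q q'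
    | .inr q, .inr q' => Q.Next q q'
    | .inr _, .inl _ => False
  refine ⟨{ K := P.K ⊕ Q.K, pos := Sum.elim P.pos Q.pos, Next := Next,
            pos_mem := ?_, cover := ?_, edge := ?_, own := ?_, opp := ?_, win := ?_ }⟩
  · rintro (k | k)
    · exact P.pos_mem k
    · exact hZ (Q.pos_mem k)
  · intro x hx
    obtain ⟨k, hk⟩ := P.cover x hx
    exact ⟨.inl k, hk⟩
  · rintro (k | q) (k' | q') hk
    · exact P.edge k k' hk.2
    · obtain ⟨q, hq, hn⟩ := hk
      have := Q.edge q q' hn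
      rwa [hq] at this
    · exact hk.elim
    · exact Q.edge q q' hk
  · rintro (k | q) hA -
    · by_cases hkZ : P.pos k ∈ Z
      · obtain ⟨q, hq⟩ := Q.cover _ hkZ
        obtain ⟨q', hq'⟩ := Q.own q (by rw [hq]; exact hA) (Set.notMem_empty _)
        exact ⟨.inr q', q, hq, hq'⟩
      · obtain ⟨k', hk'⟩ := P.own k hA hkZ
        exact ⟨.inl k', hkZ, hk'⟩
    · obtain ⟨q', hq'⟩ := Q.own q hA (Set.notMem_empty _)
      exact ⟨.inr q', hq'⟩
  · rintro (k | q) hA - y hy hxy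
    · by_cases hkZ : P.pos k ∈ Z
      · obtain ⟨q, hq⟩ := Q.cover _ hkZ
        obtain ⟨q', hq', rfl⟩ := Q.opp q (by rw [hq]; exact hA) (Set.notMem_empty _) y
          (htrap _ hkZ hA y hy hxy) (by rw [hq]; exact hxy)
        exact ⟨.inr q', ⟨q, hq, hq'⟩, rfl⟩
      · obtain ⟨k', hk', rfl⟩ := P.opp k hA hkZ y hy hxy
        exact ⟨.inl k', ⟨hkZ, hk'⟩, rfl⟩
    · obtain ⟨q', hq', rfl⟩ := Q.opp q hA (Set.notMem_empty _) y
        (htrap _ (Q.pos_mem q) hA y hy hxy) hxy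
      exact ⟨.inr q', hq', rfl⟩
  · intro κ hκ _
    have hs : ∀ i a b, κ i = Sum.inr b → κ (i + 1) ≠ Sum.inl a := by
      intro i a b hb ha
      have := hκ i
      rw [ha, hb] at this
      exact this
    rcases sum_path κ hs with ⟨f, hf⟩ | ⟨i, f, hf⟩
    · have hf' : ∀ i, P.pos (f i) ∉ Z ∧ P.Next (f i) (f (i + 1)) := by
        intro i
        have := hκ i
        rw [hf, hf] at this
        exact this
      have := P.win f (fun i => (hf' i).2) fun i => (hf' i).1
      simpa only [hf, Sum.elim_inl] using this
    · have := Q.win f (fun j => by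
        have := hκ (i + j)
        rw [hf, add_assoc, hf] at this
        exact this) fun _ => Set.notMem_empty _
      rw [← infSet_shift _ i]
      simpa only [hf, Sum.elim_inr] using this

/-! ### Winning regions as a finite certificate -/

/-- `X` is won by the player owning `A` because smaller sets in the family `T` are: either
`X` is in `𝒜` and, for each of its vertices `u`, the vertices not attracted to `u` lie in a set of
`T`, or `X` contains a set `Z` of `T` that the opponent cannot leave and the vertices not attracted
to `Z` lie in a set of `T`. -/
def Step (E : V → V → Prop) (A : Set V) (𝒜 T : Set (Set V)) (X : Set V) : Prop :=
  (∀ x, x ∉ X) ∨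
  (X ∈ 𝒜 ∧ IsArena E X ∧ ∀ u ∈ X, ∃ X' ∈ T, X' ⊆ X ∧ u ∉ X' ∧
    ∀ x ∈ X, x ∈ X' ∨ x ∈ attr E A X {u}) ∨
  (∃ Z ∈ T, ∃ X' ∈ T, Z ⊆ X ∧ X' ⊆ X ∧ ¬ X ⊆ Z ∧ ¬ X ⊆ X' ∧ IsTrap E Aᶜ X Z ∧
    ∀ x ∈ X, x ∈ X' ∨ x ∈ attr E A X Z)

/-- The player owning `A` wins from every vertex of `X` while the play is confined to `X`; the
family `T` is a certificate, in which the smaller sets justify the larger ones. -/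
def Dom (E : V → V → Prop) (A : Set V) (𝒜 : Set (Set V)) (X : Set V) : Prop :=
  ∃ T : Set (Set V), X ∈ T ∧ ∀ Y ∈ T, Step E A 𝒜 T Y

theorem Step.mono {T T' : Set (Set V)} (hT : T ⊆ T') (h : Step E A 𝒜 T X) :
    Step E A 𝒜 T' X := by
  rcases h with h | ⟨h1, h2, h3⟩ | ⟨Z, hZ, X', hX', h⟩
  · exact Or.inl h
  · refine Or.inr (Or.inl ⟨h1, h2, fun u hu => ?_⟩)
    obtain ⟨X', hX', h⟩ := h3 u hu
    exact ⟨X', hT hX', h⟩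
  · exact Or.inr (Or.inr ⟨Z, hT hZ, X', hT hX', h⟩)

/-- The union of all certificates is a certificate, and so is its extension by a justified set. -/
theorem Dom.of_step (h : Step E A 𝒜 {Y | Dom E A 𝒜 Y} X) : Dom E A 𝒜 X := by
  refine ⟨insert X {Y | Dom E A 𝒜 Y}, Set.mem_insert _ _, ?_⟩
  rintro Y (rfl | ⟨T, hY, hT⟩)
  · exact h.mono (Set.subset_insert _ _)
  · exact (hT Y hY).mono fun Z hZ => Or.inr ⟨T, hZ, hT⟩

theorem Dom.empty : Dom E A 𝒜 ∅ := Dom.of_step (Or.inl fun _ => Set.notMem_empty _)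

/-- Certificates are sound: the strategies for the smaller sets combine to one for the larger
set. -/
theorem Dom.plan [Finite V] (h : Dom E A 𝒜 X) : Nonempty (Plan E A X ∅ 𝒜) := by
  obtain ⟨T, hX, hT⟩ := h
  induction hn : X.ncard using Nat.strong_induction_on generalizing X with
  | _ n ih =>
    have ih' : ∀ Y ∈ T, Y ⊆ X → ¬ X ⊆ Y → Nonempty (Plan E A Y ∅ 𝒜) := by
      intro Y hY hYX hXY
      refine ih _ ?_ hY rfl
      rw [← hn]
      exact Set.ncard_lt_ncard ⟨hYX, hXY⟩ (Set.toFinite X)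
    rcases hT X hX with h | ⟨h1, h2, h3⟩ | ⟨Z, hZ, X', hX', hZX, hXX, hZ', hXX', htrap, h⟩
    · exact ⟨.ofEmpty h⟩
    · rcases X.eq_empty_or_nonempty with rfl | hne
      · exact ⟨.ofEmpty Set.notMem_empty⟩
      refine Plan.cycle h1 hne h2 fun u hu => ?_
      obtain ⟨X', hX', hXX, huX, hall⟩ := h3 u hu
      obtain ⟨P⟩ := ih' X' hX' hXX fun h => huX (h hu)
      exact P.attract hXX (Set.singleton_subset_iff.2 hu) hall
    · obtain ⟨Q⟩ := ih' Z hZ hZX hZ'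
      obtain ⟨P⟩ := ih' X' hX' hXX hXX'
      obtain ⟨P⟩ := P.attract hXX hZX h
      exact P.split Q hZX htrap

/-! ### Determinacy -/

/-- McNaughton's induction step, for an arena `X` that is itself in `𝒜`. -/
theorem determined_of_mem [Finite V] (harena : IsArena E X) (hX : X ∈ 𝒜)
    (ih : ∀ Y, Y ⊆ X → ¬ X ⊆ Y → IsArena E Y → ∃ W ⊆ Y, Dom E A 𝒜 W ∧ Dom E Aᶜ 𝒜ᶜ (Y \ W) ∧
      IsTrap E Aᶜ Y W ∧ IsTrap E A Y (Y \ W)) :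
    ∃ W ⊆ X, Dom E A 𝒜 W ∧ Dom E Aᶜ 𝒜ᶜ (X \ W) ∧ IsTrap E Aᶜ X W ∧ IsTrap E A X (X \ W) := by
  have hsub : ∀ u ∈ X, ¬ X ⊆ X \ attr E A X {u} := fun u hu h =>
    (h hu).2 (subset_attr rfl)
  by_cases hall : ∀ u ∈ X, Dom E A 𝒜 (X \ attr E A X {u})
  · -- aiming at the vertices of `X` in turn wins: a play that avoids some `u` from some step on
    -- stays in `X \ attr E A X {u}`, and otherwise all of `X` is visited infinitely often
    refine ⟨X, subset_rfl, Dom.of_step (Or.inr (Or.inl ⟨hX, harena, fun u hu =>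
      ⟨_, hall u hu, Set.sdiff_subset, fun h => h.2 (subset_attr rfl), fun x hx => ?_⟩⟩)),
      ?_, fun x _ _ y hy _ => hy, ?_⟩
    · by_cases hxa : x ∈ attr E A X {u}
      · exact Or.inr hxa
      · exact Or.inl ⟨hx, hxa⟩
    · rw [Set.sdiff_self]; exact Dom.empty
    · rw [Set.sdiff_self]; exact fun x hx => hx.elim
  · push Not at hall
    obtain ⟨u, hu, hnot⟩ := hall
    obtain ⟨W, hWY, hW, hZ, -, hZtrap⟩ :=
      ih _ Set.sdiff_subset (hsub u hu) (harena.diff_attr (A := A) (Z := {u}))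
    set Xu := X \ attr E A X {u} with hXu
    -- the opponent wins on the nonempty set `Z`, which the owner of `A` cannot leave in `X`
    set Z := Xu \ W with hZdef
    have hZXu : Z ⊆ Xu := Set.sdiff_subset
    have hZX : Z ⊆ X := hZXu.trans Set.sdiff_subset
    have hZne : Z.Nonempty := by
      by_contra h
      rw [Set.not_nonempty_iff_eq_empty, hZdef, Set.sdiff_eq_empty] at h
      exact hnot (by rwa [hWY.antisymm h] at hW)
    have hZtrapX : IsTrap E A X Z := isTrap_diff_attr.trans hZtrap hZXu
    set B := attr E Aᶜ X Z with hB
    have hBX : B ⊆ X := attr_subset hZX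
    have hZB : Z ⊆ B := subset_attr
    have hXB : ¬ X ⊆ X \ B := by
      obtain ⟨z, hz⟩ := hZne
      exact fun h => (h (hZX hz)).2 (hZB hz)
    obtain ⟨W', hWY', hW', hU', hWtrap, hUtrap⟩ :=
      ih _ Set.sdiff_subset hXB (harena.diff_attr (A := Aᶜ) (Z := Z))
    have hXW : X \ W' = B ∪ ((X \ B) \ W') := by
      ext x
      constructor
      · rintro ⟨hx, hxW⟩
        by_cases hxB : x ∈ B
        · exact Or.inl hxB
        · exact Or.inr ⟨⟨hx, hxB⟩, hxW⟩
      · rintro (hx | ⟨⟨hx, -⟩, hxW⟩)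
        · exact ⟨hBX hx, fun h => (hWY' h).2 hx⟩
        · exact ⟨hx, hxW⟩
    have hBtrap : IsTrap E A X B := by
      have := IsTrap.attr (A := Aᶜ) (by rwa [compl_compl] : IsTrap E Aᶜᶜ X Z)
      rwa [compl_compl] at this
    have hUX : IsTrap E A X (X \ W') := by
      intro x hx hA y hy hxy
      refine ⟨hy, fun hyW => ?_⟩
      rw [hXW] at hx
      rcases hx with hx | hx
      · exact (hWY' hyW).2 (hBtrap x hx hA y hy hxy)
      · exact (hUtrap x hx hA y (hWY' hyW) hxy).2 hyW
    refine ⟨W', hWY'.trans Set.sdiff_subset, hW', ?_, ?_, hUX⟩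
    · by_cases hWZ : X \ W' ⊆ Z
      · have : X \ W' = Z := hWZ.antisymm (by rw [hXW]; exact hZB.trans Set.subset_union_left)
        rwa [this]
      refine Dom.of_step (Or.inr (Or.inr ⟨Z, hZ, (X \ B) \ W', hU', ?_, ?_, hWZ, ?_, ?_, ?_⟩))
      · rw [hXW]; exact hZB.trans Set.subset_union_left
      · rw [hXW]; exact Set.subset_union_right
      · intro h
        obtain ⟨z, hz⟩ := hZne
        rw [hXW] at h
        exact (h (Or.inl (hZB hz))).1.2 (hZB hz)
      · rw [compl_compl]
        exact fun x hx hA y hy hxy => hZtrapX x hx hA y hy.1 hxy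
      · intro x hx
        rw [hXW] at hx
        refine hx.symm.imp_right fun hx => attr_subset_attr Set.sdiff_subset ?_ hx
        rw [hXW]
        exact Set.subset_union_left
    · exact (isTrap_diff_attr (A := Aᶜ)).trans hWtrap hWY'

/-- Muller games on finite arenas are determined. -/
theorem determined [Finite V] (harena : IsArena E X) :
    ∃ W ⊆ X, Dom E A 𝒜 W ∧ Dom E Aᶜ 𝒜ᶜ (X \ W) ∧ IsTrap E Aᶜ X W ∧ IsTrap E A X (X \ W) := by
  induction hn : X.ncard using Nat.strong_induction_on generalizing X A 𝒜 with
  | _ n ih =>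
    have ih' : ∀ A : Set V, ∀ 𝒜 : Set (Set V), ∀ Y, Y ⊆ X → ¬ X ⊆ Y → IsArena E Y → _ :=
      fun A 𝒜 Y hYX hXY hY => ih _ (hn ▸ Set.ncard_lt_ncard ⟨hYX, hXY⟩ (Set.toFinite X))
        (A := A) (𝒜 := 𝒜) hY rfl
    -- the player whose condition contains `X` takes the role of the owner of `A`
    by_cases hX : X ∈ 𝒜
    · exact determined_of_mem harena hX (ih' A 𝒜)
    · obtain ⟨W, hWX, h1, h2, h3, h4⟩ := determined_of_mem (A := Aᶜ) harena
        (show X ∈ 𝒜ᶜ from hX) (ih' Aᶜ 𝒜ᶜ)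
      rw [compl_compl, compl_compl] at h2
      rw [compl_compl] at h3
      refine ⟨X \ W, Set.sdiff_subset, h2, ?_, h4, ?_⟩ <;> rwa [sdiff_sdiff_right_self,
        inf_of_le_right (by exact hWX)]

end MullerGame

namespace MullerGame

variable {V : Type} {E : V → V → Prop} {A X Y Z : Set V} {𝒜 : Set (Set V)}

/-- The player owning `A` wins from `v` the game with winning condition `𝒜` and the additional
requirement that the play stays in `Z`. -/
def WinsFrom (E : V → V → Prop) (A : Set V) (𝒜 : Set (Set V)) (Z : Set V) (v : V) : Prop :=
  ∃ Y : Set V, v ∈ Y ∧ Y ⊆ Z ∧ IsTrap E Aᶜ Set.univ Y ∧ Dom E A 𝒜 Y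

/-- A strategy graph is turned into a deterministic strategy `c` that reads the vertices visited so
far: every play that follows `c`, wherever `c` proposes an edge, is won. -/
theorem Plan.exists_choice (P : Plan E A Y ∅ 𝒜) (htrap : IsTrap E Aᶜ Set.univ Y) {v : V}
    (hv : v ∈ Y) :
    ∃ c : List V → V, ∀ ρ : ℕ → V, ρ 0 = v → (∀ i, E (ρ i) (ρ (i + 1))) →
      (∀ i, ρ i ∈ A → E (ρ i) (c ((List.range (i + 1)).map ρ)) →
        ρ (i + 1) = c ((List.range (i + 1)).map ρ)) → infSet ρ ∈ 𝒜 := by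
  classical
  obtain ⟨k₀, hk₀⟩ := P.cover v hv
  let upd : P.K → V → P.K := fun k w =>
    if h : ∃ k', P.Next k k' ∧ P.pos k' = w then h.choose else k
  let mv : P.K → V := fun k => if h : ∃ k', P.Next k k' then P.pos h.choose else P.pos k
  refine ⟨fun l => mv (l.tail.foldl upd k₀), fun ρ h0 hE hc => ?_⟩
  let κ : ℕ → P.K := fun i => ((List.range (i + 1)).map ρ).tail.foldl upd k₀
  have hκ : ∀ i, κ (i + 1) = upd (κ i) (ρ (i + 1)) := by
    intro i
    simp only [κ]
    rw [List.range_succ (n := i + 1), List.map_append, List.tail_append_of_ne_nil (by simp),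
      List.foldl_append]
    rfl
  have hnext : ∀ i, P.pos (κ i) = ρ i →
      P.Next (κ i) (κ (i + 1)) ∧ P.pos (κ (i + 1)) = ρ (i + 1) := by
    intro i hi
    have hex : ∃ k', P.Next (κ i) k' ∧ P.pos k' = ρ (i + 1) := by
      by_cases hA : ρ i ∈ A
      · have hex := P.own (κ i) (by rwa [hi]) (Set.notMem_empty _)
        have hmv : mv (κ i) = P.pos hex.choose := dif_pos hex
        refine ⟨hex.choose, hex.choose_spec, ?_⟩
        rw [← hmv]
        refine (hc i hA ?_).symm
        have := P.edge _ _ hex.choose_spec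
        rw [hi, ← hmv] at this
        exact this
      · have hY : ρ i ∈ Y := hi ▸ P.pos_mem (κ i)
        exact P.opp (κ i) (by rwa [hi]) (Set.notMem_empty _) _
          (htrap _ hY hA _ (Set.mem_univ _) (hE i)) (by rw [hi]; exact hE i)
    rw [hκ]
    have : upd (κ i) (ρ (i + 1)) = hex.choose := dif_pos hex
    rw [this]
    exact hex.choose_spec
  have hpos : ∀ i, P.pos (κ i) = ρ i := by
    intro i
    induction i with
    | zero => rw [h0, ← hk₀]; rfl
    | succ i ih => exact (hnext i ih).2
  have := P.win κ (fun i => (hnext i (hpos i)).1) fun _ => Set.notMem_empty _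
  simpa only [hpos] using this

/-- If one player owns all vertices, then winning means that a suitable path exists. -/
theorem winsFrom_univ_iff [Finite V] {v : V} :
    WinsFrom E Set.univ 𝒜 Z v ↔
      ∃ ρ : ℕ → V, ρ 0 = v ∧ (∀ i, E (ρ i) (ρ (i + 1))) ∧ (∀ i, ρ i ∈ Z) ∧ infSet ρ ∈ 𝒜 := by
  constructor
  · rintro ⟨Y, hvY, hYZ, -, hD⟩
    obtain ⟨P⟩ := hD.plan
    obtain ⟨k₀, hk₀⟩ := P.cover v hvY
    choose s hs using fun k => P.own k (Set.mem_univ _) (Set.notMem_empty _)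
    let κ : ℕ → P.K := fun i => s^[i] k₀
    have hκ : ∀ i, P.Next (κ i) (κ (i + 1)) := by
      intro i
      simp only [κ, Function.iterate_succ_apply']
      exact hs _
    exact ⟨fun i => P.pos (κ i), hk₀, fun i => P.edge _ _ (hκ i), fun i => hYZ (P.pos_mem _),
      P.win κ hκ fun _ => Set.notMem_empty _⟩
  · rintro ⟨ρ, h0, hE, hZ, hρ⟩
    have harena : IsArena E (Set.range ρ) := by
      rintro _ ⟨i, rfl⟩
      exact ⟨_, ⟨i + 1, rfl⟩, hE i⟩
    obtain ⟨W, hWX, hW, hU, -, htrap⟩ := determined (A := Set.univ) (𝒜 := 𝒜) harena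
    refine ⟨W, ?_, fun x hx => ?_, fun x _ hx => absurd (Set.mem_univ x) hx, hW⟩
    · -- otherwise the path would also be a play of the opponent's winning strategy
      by_contra hv
      obtain ⟨Q⟩ := hU.plan
      have hstep : ∀ k i, Q.pos k = ρ i → ∃ k', Q.Next k k' ∧ Q.pos k' = ρ (i + 1) := by
        intro k i hk
        have hmem := Q.pos_mem k
        rw [hk] at hmem
        refine Q.opp k (by simp) (Set.notMem_empty _) _ ?_ (by rw [hk]; exact hE i)
        exact htrap _ hmem (Set.mem_univ _) _ ⟨i + 1, rfl⟩ (hE i)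
      obtain ⟨k₀, hk₀⟩ := Q.cover (ρ 0) ⟨⟨0, rfl⟩, by rwa [h0]⟩
      choose! s hs using hstep
      let κ : ∀ i, {k // Q.pos k = ρ i} := fun i =>
        Nat.rec ⟨k₀, hk₀⟩ (fun i k => ⟨s k.1 i, (hs k.1 i k.2).2⟩) i
      have := Q.win (fun i => (κ i).1) (fun i => (hs _ i (κ i).2).1) fun _ => Set.notMem_empty _
      simp only [(κ _).2] at this
      exact this hρ
    · obtain ⟨i, rfl⟩ := hWX hx
      exact hZ i

end MullerGame

namespace GameArena

open MullerGame

variable {P V : Type} {G : GameArena P V}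

/-! ### Plays, histories and outcomes -/

/-- `(v, w)` is an edge of the arena. -/
def Edge (G : GameArena P V) (v w : V) : Prop := (v, w) ∈ G.edges

theorem map_range_succ (ρ : ℕ → V) (i : ℕ) :
    (List.range (i + 1)).map ρ = (List.range i).map ρ ++ [ρ i] := by
  rw [List.range_succ, List.map_append]; rfl

theorem map_range_congr {ρ ρ' : ℕ → V} {i : ℕ} (h : ∀ j < i, ρ j = ρ' j) :
    (List.range i).map ρ = (List.range i).map ρ' :=
  List.map_congr_left fun j hj => h j (List.mem_range.1 hj)

/-- The vertices reachable from the initial vertex. -/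
def reachable (G : GameArena P V) : Set V := {v | Relation.ReflTransGen G.Edge G.init v}

theorem init_mem_reachable : G.init ∈ G.reachable := Relation.ReflTransGen.refl

theorem reachable_of_edge {v w : V} (hv : v ∈ G.reachable) (h : G.Edge v w) : w ∈ G.reachable :=
  Relation.ReflTransGen.tail hv h

theorem mem_reachable_of_path {ρ : ℕ → V} (h0 : ρ 0 = G.init) {n : ℕ}
    (h : ∀ i < n, G.Edge (ρ i) (ρ (i + 1))) : ρ n ∈ G.reachable := by
  induction n with
  | zero => rw [h0]; exact init_mem_reachable
  | succ n ih => exact reachable_of_edge (ih fun i hi => h i (by omega)) (h n (by omega))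

/-- A finite path from the initial vertex is a history, since it extends to a play. -/
theorem isHistory_of_path (hG : G.NonBlocking) {ρ : ℕ → V} (h0 : ρ 0 = G.init) {n : ℕ}
    (h : ∀ i < n, G.Edge (ρ i) (ρ (i + 1))) : G.IsHistory ((List.range (n + 1)).map ρ) := by
  have hs : ∀ v : G.reachable, ∃ w : G.reachable, G.Edge v w := by
    rintro ⟨v, hv⟩
    obtain ⟨w, hw⟩ := hG v hv
    exact ⟨⟨w, reachable_of_edge hv hw⟩, hw⟩
  choose s hs using hs
  let x : ℕ → G.reachable := fun i => s^[i] ⟨ρ n, mem_reachable_of_path h0 h⟩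
  have hx : ∀ i, G.Edge (x i) (x (i + 1)) := by
    intro i
    simp only [x, Function.iterate_succ_apply']
    exact hs _
  refine ⟨fun i => if i < n then ρ i else x (i - n), ⟨?_, fun i => ?_⟩, n, ?_⟩
  · by_cases hn : 0 < n
    · simp [hn, h0]
    · obtain rfl : n = 0 := by omega
      simp [x, h0]
  · change G.Edge (if i < n then ρ i else x (i - n))
      (if i + 1 < n then ρ (i + 1) else x (i + 1 - n))
    rcases lt_trichotomy (i + 1) n with hi | hi | hi
    · rw [if_pos hi, if_pos (by omega)]
      exact h i (by omega)
    · subst hi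
      rw [if_pos (by omega), if_neg (by omega), Nat.sub_self]
      exact h i (by omega)
    · rw [if_neg (by omega : ¬ i < n), if_neg (by omega), Nat.sub_add_comm (by omega)]
      exact hx _
  · rw [map_range_succ, map_range_succ]
    congr 1
    · exact map_range_congr fun j hj => (if_pos hj).symm
    · simp [x]

theorem isHistory_of_mem_plays {ρ : ℕ → V} (hρ : ρ ∈ G.plays) (i : ℕ) :
    G.IsHistory ((List.range i).map ρ ++ [ρ i]) := ⟨ρ, hρ, i, (map_range_succ ρ i).symm⟩

theorem IsHistory.exists_path {h : List V} {v : V} (hh : G.IsHistory (h ++ [v])) :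
    ∃ ρ ∈ G.plays, ∃ i, h = (List.range i).map ρ ∧ v = ρ i := by
  obtain ⟨ρ, hρ, i, hi⟩ := hh
  rw [map_range_succ] at hi
  obtain ⟨h1, h2⟩ := List.append_inj' hi rfl
  exact ⟨ρ, hρ, i, h1, by simpa using h2⟩

theorem IsHistory.snoc (hG : G.NonBlocking) {h : List V} {v w : V} (hh : G.IsHistory (h ++ [v]))
    (hw : G.Edge v w) : G.IsHistory (h ++ [v] ++ [w]) := by
  obtain ⟨ρ, hρ, i, rfl, rfl⟩ := hh.exists_path
  have h1 : ∀ j ≤ i, (if j ≤ i then ρ j else w) = ρ j := fun j hj => if_pos hj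
  have := isHistory_of_path hG (ρ := fun j => if j ≤ i then ρ j else w) (n := i + 1)
    (by simp [hρ.1]) (fun j hj => by
      rw [if_pos (by omega : j ≤ i)]
      rcases Nat.lt_succ_iff_lt_or_eq.1 hj with hj | rfl
      · rw [if_pos (by omega : j + 1 ≤ i)]; exact hρ.2 j
      · rw [if_neg (by omega)]; exact hw)
  rw [map_range_succ, map_range_succ, h1 i le_rfl, if_neg (by omega),
    map_range_congr fun j hj => h1 j (by omega)] at this
  exact this

theorem Profile.run_fst (σ : G.Profile) (i : ℕ) : (σ.run i).1 = (List.range i).map σ.out := by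
  induction i with
  | zero => rfl
  | succ i ih => rw [map_range_succ, ← ih]; rfl

theorem Profile.out_succ (σ : G.Profile) (i : ℕ) :
    σ.out (i + 1) = (σ (G.owner (σ.out i))).move ((List.range i).map σ.out) (σ.out i) := by
  rw [← Profile.run_fst]; rfl

theorem Profile.out_mem_plays (hG : G.NonBlocking) (σ : G.Profile) : σ.out ∈ G.plays := by
  refine ⟨rfl, fun i => ?_⟩
  induction i using Nat.strong_induction_on with
  | _ i ih =>
    have := isHistory_of_path hG (ρ := σ.out) rfl ih
    rw [map_range_succ] at this
    rw [σ.out_succ]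
    exact (σ _).legal _ _ this rfl

theorem Profile.out_eq {σ : G.Profile} {ρ : ℕ → V} (h0 : ρ 0 = G.init)
    (h : ∀ i, ρ (i + 1) = (σ (G.owner (ρ i))).move ((List.range i).map ρ) (ρ i)) :
    σ.out = ρ := by
  funext i
  induction i using Nat.strong_induction_on with
  | _ i ih =>
    cases i with
    | zero => exact h0.symm
    | succ i =>
      rw [σ.out_succ, h, ih i (by omega), map_range_congr fun j hj => ih j (by omega)]

open Classical in
/-- The strategy that moves to `c h` after the history `h`, provided that this is legal. -/
noncomputable def Strategy.ofChoice (G : GameArena P V) (p : P) (c : List V → V) :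
    G.Strategy p where
  move h v := if G.Edge v (c (h ++ [v])) then c (h ++ [v])
    else if hex : ∃ w, G.Edge v w then hex.choose else v
  legal h v hh _ := by
    obtain ⟨ρ, hρ, i, -, rfl⟩ := hh.exists_path
    have hex : ∃ w, G.Edge (ρ i) w := ⟨_, hρ.2 i⟩
    by_cases hc : G.Edge (ρ i) (c (h ++ [ρ i]))
    · rw [if_pos hc]; exact hc
    · rw [if_neg hc, dif_pos hex]; exact hex.choose_spec

theorem Strategy.ofChoice_move {p : P} {c : List V → V} {h : List V} {v : V}
    (hc : G.Edge v (c (h ++ [v]))) : (Strategy.ofChoice G p c).move h v = c (h ++ [v]) :=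
  if_pos hc

/-- A strategy graph for the player owning `A` can be played, from step `i` of the play `ρ` on,
against given moves `f` at the other vertices. -/
theorem exists_play_against (hG : G.NonBlocking) {A Y : Set V} {𝒜 : Set (Set V)}
    (Q : Plan G.Edge A Y ∅ 𝒜) (htrap : IsTrap G.Edge Aᶜ Set.univ Y) {ρ : ℕ → V}
    (hρ : ρ ∈ G.plays) {i : ℕ} (hi : ρ i ∈ Y) {f : List V → V → V}
    (hf : ∀ h v, G.IsHistory (h ++ [v]) → v ∉ A → G.Edge v (f h v)) :
    ∃ ρ' ∈ G.plays, (∀ j ≤ i, ρ' j = ρ j) ∧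
      (∀ j ≥ i, ρ' j ∉ A → ρ' (j + 1) = f ((List.range j).map ρ') (ρ' j)) ∧ infSet ρ' ∈ 𝒜 := by
  have hstep : ∀ s : {s : List V × Q.K // G.IsHistory (s.1 ++ [Q.pos s.2])},
      ∃ s' : {s : List V × Q.K // G.IsHistory (s.1 ++ [Q.pos s.2])},
        s'.1.1 = s.1.1 ++ [Q.pos s.1.2] ∧ Q.Next s.1.2 s'.1.2 ∧
          (Q.pos s.1.2 ∉ A → Q.pos s'.1.2 = f s.1.1 (Q.pos s.1.2)) := by
    rintro ⟨⟨h, k⟩, hh⟩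
    by_cases hA : Q.pos k ∈ A
    · obtain ⟨k', hk'⟩ := Q.own k hA (Set.notMem_empty _)
      exact ⟨⟨(h ++ [Q.pos k], k'), hh.snoc hG (Q.edge _ _ hk')⟩, rfl, hk', fun h => absurd hA h⟩
    · have hE := hf h _ hh hA
      obtain ⟨k', hk', hpos⟩ := Q.opp k hA (Set.notMem_empty _) _
        (htrap _ (Q.pos_mem k) hA _ (Set.mem_univ _) hE) hE
      exact ⟨⟨(h ++ [Q.pos k], k'), hh.snoc hG (Q.edge _ _ hk')⟩, rfl, hk', fun _ => hpos⟩
  choose s hs1 hs2 hs3 using hstep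
  obtain ⟨k₀, hk₀⟩ := Q.cover _ hi
  let κ : ℕ → {s : List V × Q.K // G.IsHistory (s.1 ++ [Q.pos s.2])} := fun m =>
    s^[m] ⟨((List.range i).map ρ, k₀), by simp only [hk₀]; exact isHistory_of_mem_plays hρ i⟩
  have hκ : ∀ m, κ (m + 1) = s (κ m) := fun m => Function.iterate_succ_apply' _ _ _
  let ρ' : ℕ → V := fun j => if j < i then ρ j else Q.pos (κ (j - i)).1.2
  have hlow : ∀ j ≤ i, ρ' j = ρ j := by
    intro j hj
    rcases hj.lt_or_eq with hj | rfl
    · exact if_pos hj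
    · simp [ρ', κ, hk₀]
  have hhigh : ∀ m, ρ' (i + m) = Q.pos (κ m).1.2 := by intro m; simp [ρ']
  have hhist : ∀ m, (κ m).1.1 = (List.range (i + m)).map ρ' := by
    intro m
    induction m with
    | zero => exact map_range_congr fun j hj => (hlow j (by omega)).symm
    | succ m ih => rw [hκ, hs1, ih, ← add_assoc, map_range_succ, hhigh]
  refine ⟨ρ', ⟨?_, fun j => ?_⟩, hlow, fun j hj hA => ?_, ?_⟩
  · rw [hlow 0 (by omega)]; exact hρ.1
  · by_cases hj : j < i
    · rw [hlow j (by omega), hlow (j + 1) (by omega)]; exact hρ.2 j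
    · obtain ⟨m, rfl⟩ := Nat.exists_eq_add_of_le (not_lt.1 hj)
      rw [add_assoc, hhigh, hhigh, hκ]
      exact Q.edge _ _ (hs2 _)
  · obtain ⟨m, rfl⟩ := Nat.exists_eq_add_of_le hj
    rw [hhigh] at hA
    rw [add_assoc, hhigh, hhigh, hκ, ← hhist]
    exact hs3 _ hA
  · rw [← infSet_shift _ i]
    simp only [hhigh]
    exact Q.win (fun m => (κ m).1.2) (fun m => by simp only [hκ]; exact hs2 _)
      fun _ => Set.notMem_empty _

/-! ### Winning in an arena -/

/-- Determinacy of the game played on the whole arena, from a reachable vertex. Restricting the game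
to the reachable vertices provides every vertex with a successor. -/
theorem winsFrom_or [Finite V] (hG : G.NonBlocking) (A : Set V) (𝒜 : Set (Set V)) {v : V}
    (hv : v ∈ G.reachable) :
    WinsFrom G.Edge A 𝒜 Set.univ v ∨ WinsFrom G.Edge Aᶜ 𝒜ᶜ Set.univ v := by
  have harena : IsArena G.Edge G.reachable := by
    intro x hx
    obtain ⟨w, hw⟩ := hG x hx
    exact ⟨w, reachable_of_edge hx hw, hw⟩
  obtain ⟨W, hWR, hW, hU, hWt, hUt⟩ := determined (A := A) (𝒜 := 𝒜) harena
  by_cases h : v ∈ W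
  · exact Or.inl ⟨W, h, Set.subset_univ _, fun x hx hA y _ hxy =>
      hWt x hx hA y (reachable_of_edge (hWR hx) hxy) hxy, hW⟩
  · refine Or.inr ⟨G.reachable \ W, ⟨hv, h⟩, Set.subset_univ _, fun x hx hA y _ hxy => ?_, hU⟩
    rw [compl_compl] at hA
    exact hUt x hx hA y (reachable_of_edge hx.1 hxy) hxy

/-- A winning strategy of `p` excludes a winning strategy of the other players, since a play that is
consistent with both exists; by determinacy, `p` then wins the Muller game. -/
theorem mem_winnable_iff [Finite V] (hG : G.NonBlocking) (p : P) (𝒜 : Set (Set V)) :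
    {ρ ∈ G.plays | infSet ρ ∈ 𝒜} ∈ G.winnable p ↔
      WinsFrom G.Edge {v | G.owner v = p} 𝒜 Set.univ G.init := by
  constructor
  · rintro ⟨τ, hτ⟩
    refine (winsFrom_or hG _ 𝒜 init_mem_reachable).resolve_right ?_
    rintro ⟨Y, hvY, -, htrap, hD⟩
    obtain ⟨Q⟩ := hD.plan
    have hhist := isHistory_of_path hG (ρ := fun _ => G.init) rfl (n := 0) (by simp)
    obtain ⟨ρ₀, hρ₀, -⟩ := hhist
    obtain ⟨ρ, hρ, -, hcons, hinf⟩ := exists_play_against hG Q htrap hρ₀ (i := 0)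
      (by rw [hρ₀.1]; exact hvY) (f := τ.move) (fun h v hh hv => τ.legal h v hh (by simpa using hv))
    have hmem : ρ ∈ τ.outs := ⟨hρ, fun i hi => hcons i (Nat.zero_le _) (by simpa using hi)⟩
    exact hinf (hτ hmem).2
  · rintro ⟨Y, hvY, -, htrap, hD⟩
    obtain ⟨Q⟩ := hD.plan
    obtain ⟨c, hc⟩ := Q.exists_choice htrap hvY
    refine ⟨Strategy.ofChoice G p c, fun ρ hρ => ⟨hρ.1, hc ρ hρ.1.1 hρ.1.2 fun i hi hE => ?_⟩⟩
    rw [hρ.2 i hi]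
    rw [map_range_succ] at hE ⊢
    exact Strategy.ofChoice_move hE

/-! ### Equilibria -/

/-- Every play that is consistent with the strategies of the other players is the outcome of a
deviation of `p`. -/
theorem exists_deviation [DecidableEq P] {σ : G.Profile} {p : P} {ρ : ℕ → V} (hρ : ρ ∈ G.plays)
    (h : ∀ i, G.owner (ρ i) ≠ p →
      ρ (i + 1) = (σ (G.owner (ρ i))).move ((List.range i).map ρ) (ρ i)) :
    ∃ τ : G.Strategy p, Profile.out (Function.update σ p τ) = ρ := by
  refine ⟨Strategy.ofChoice G p fun l => ρ l.length, Profile.out_eq hρ.1 fun i => ?_⟩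
  by_cases hp : G.owner (ρ i) = p
  · subst hp
    rw [Function.update_self, Strategy.ofChoice_move] <;> simp
    exact hρ.2 i
  · rw [Function.update_of_ne hp]
    exact h i hp

theorem out_update_succ [DecidableEq P] {σ : G.Profile} {p : P} {τ : G.Strategy p} {i : ℕ}
    (h : G.owner (Profile.out (Function.update σ p τ) i) ≠ p) :
    Profile.out (Function.update σ p τ) (i + 1) =
      (σ (G.owner (Profile.out (Function.update σ p τ) i))).move
        ((List.range i).map (Profile.out (Function.update σ p τ)))
        (Profile.out (Function.update σ p τ) i) := by
  rw [Profile.out_succ, Function.update_of_ne h]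

open Classical in
/-- The joint strategy that follows the play `ρ` and answers a first deviation from `ρ` at step `i`
by the strategy `c p v`, where `p` is the player who deviated and `v` is the vertex at step `i`. -/
noncomputable def punish (G : GameArena P V) (ρ : ℕ → V) (c : P → V → List V → V)
    (l : List V) : V :=
  if h : ∃ d < l.length, l[d]? ≠ some (ρ d) then
    let i := Nat.find h - 1
    c (G.owner (ρ i)) (ρ i) (l.drop i)
  else ρ l.length

theorem punish_map_range {ρ : ℕ → V} {c : P → V → List V → V} (n : ℕ) :
    punish G ρ c ((List.range n).map ρ) = ρ n := by
  rw [punish, dif_neg]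
  · simp
  · rintro ⟨d, hd, h⟩
    refine h ?_
    simp at hd
    simp [hd]

theorem punish_deviation {ρ ρ' : ℕ → V} {c : P → V → List V → V} {i n : ℕ}
    (heq : ∀ j ≤ i, ρ' j = ρ j) (hne : ρ' (i + 1) ≠ ρ (i + 1)) (hn : i + 1 < n) :
    punish G ρ c ((List.range n).map ρ') =
      c (G.owner (ρ i)) (ρ i) ((List.range (n - i)).map fun j => ρ' (i + j)) := by
  classical
  have hget : ∀ d < n, ((List.range n).map ρ')[d]? = some (ρ' d) := by
    intro d hd
    simp [hd]
  have hex : ∃ d < ((List.range n).map ρ').length, ((List.range n).map ρ')[d]? ≠ some (ρ d) :=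
    ⟨i + 1, by simpa using hn, by rw [hget _ hn]; simpa using hne⟩
  have hfind : Nat.find hex = i + 1 := by
    rw [Nat.find_eq_iff]
    refine ⟨⟨by simpa using hn, by rw [hget _ hn]; simpa using hne⟩, ?_⟩
    rintro m hm ⟨-, h⟩
    rw [hget _ (by omega), heq m (by omega)] at h
    exact h rfl
  have hdrop : ((List.range n).map ρ').drop i = (List.range (n - i)).map fun j => ρ' (i + j) := by
    apply List.ext_getElem <;> simp
  rw [punish, dif_pos hex]
  simp only
  rw [show Nat.find _ = i + 1 from by convert hfind, Nat.add_sub_cancel, hdrop]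

/-- The Folk-theorem characterization: a profile all of whose deviations by a player `p` have an
infinity set in `𝒢 p S`, where `S` is the infinity set of the outcome, exists if and only if for
some `S` there is a play with infinity set `S` which visits only vertices from which, for each `p`,
the coalition against `p` wins the Muller game with winning condition `𝒢 p S`. -/
theorem exists_profile_iff [Finite V] [DecidableEq P] (hG : G.NonBlocking)
    {𝒢 : P → Set V → Set (Set V)} (hrefl : ∀ p S, S ∈ 𝒢 p S) :
    (∃ σ : G.Profile, ∀ (p : P) (τ : G.Strategy p),
      infSet (Profile.out (Function.update σ p τ)) ∈ 𝒢 p (infSet σ.out)) ↔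
    ∃ S Z : Set V, WinsFrom G.Edge Set.univ {S} Z G.init ∧
      ∀ p, ∀ v ∈ Z, WinsFrom G.Edge {v | G.owner v ≠ p} (𝒢 p S) Set.univ v := by
  constructor
  · rintro ⟨σ, hσ⟩
    have hout := σ.out_mem_plays hG
    -- if the coalition could not win from `σ.out i`, then `p` would have a winning strategy from
    -- there, and could deviate to it at step `i`
    refine ⟨infSet σ.out, Set.range σ.out, winsFrom_univ_iff.2 ⟨σ.out, rfl, hout.2,
      fun i => ⟨i, rfl⟩, rfl⟩, ?_⟩
    rintro p _ ⟨i, rfl⟩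
    refine (winsFrom_or hG _ _ (mem_reachable_of_path rfl fun j _ => hout.2 j)).resolve_right ?_
    rintro ⟨Y, hvY, -, htrap, hD⟩
    obtain ⟨Q⟩ := hD.plan
    obtain ⟨ρ, hρ, hlow, hcons, hinf⟩ := exists_play_against hG Q htrap hout hvY
      (f := fun h v => (σ (G.owner v)).move h v) fun h v hh _ => (σ _).legal h v hh rfl
    obtain ⟨τ, hτ⟩ := exists_deviation (σ := σ) (p := p) hρ (fun j hj => by
      by_cases hji : j < i
      · rw [hlow j (by omega), hlow (j + 1) (by omega), σ.out_succ,
          map_range_congr fun m hm => hlow m (by omega)]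
      · exact hcons j (not_lt.1 hji) (by simpa using hj))
    have := hσ p τ
    rw [hτ] at this
    exact hinf this
  · rintro ⟨S, Z, hS, hZ⟩
    obtain ⟨ρ, h0, hE, hρZ, rfl⟩ := winsFrom_univ_iff.1 hS
    have hc : ∀ p v, ∃ c : List V → V, v ∈ Z → ∀ ρ' : ℕ → V, ρ' 0 = v →
        (∀ i, G.Edge (ρ' i) (ρ' (i + 1))) →
        (∀ i, G.owner (ρ' i) ≠ p → G.Edge (ρ' i) (c ((List.range (i + 1)).map ρ')) →
          ρ' (i + 1) = c ((List.range (i + 1)).map ρ')) → infSet ρ' ∈ 𝒢 p (infSet ρ) := by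
      intro p v
      by_cases hv : v ∈ Z
      · obtain ⟨Y, hvY, -, htrap, hD⟩ := hZ p v hv
        obtain ⟨Q⟩ := hD.plan
        obtain ⟨c, hc⟩ := Q.exists_choice htrap hvY
        exact ⟨c, fun _ => hc⟩
      · exact ⟨fun _ => v, fun h => absurd h hv⟩
    choose c hc using hc
    let σ : G.Profile := fun p => Strategy.ofChoice G p (punish G ρ c)
    have hmove : ∀ q i, (σ q).move ((List.range i).map ρ) (ρ i) = ρ (i + 1) := by
      intro q i
      have h1 : punish G ρ c ((List.range i).map ρ ++ [ρ i]) = ρ (i + 1) := by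
        rw [← map_range_succ, punish_map_range]
      have := Strategy.ofChoice_move (G := G) (p := q) (c := punish G ρ c)
        (h := (List.range i).map ρ) (v := ρ i) (by rw [h1]; exact hE i)
      rw [h1] at this
      exact this
    have hσ : σ.out = ρ := Profile.out_eq h0 fun i => (hmove _ i).symm
    refine ⟨σ, fun p τ => ?_⟩
    rw [hσ]
    set ρ' := Profile.out (Function.update σ p τ) with hρ'
    have hplay : ρ' ∈ G.plays := Profile.out_mem_plays hG _
    by_cases hne : ρ' = ρ
    · rw [hne]; exact hrefl p _
    classical
    have hex : ∃ d, ρ' d ≠ ρ d := by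
      by_contra h
      push Not at h
      exact hne (funext h)
    have hd := Nat.find_spec hex
    have hmin := fun j => @Nat.find_min _ _ hex j
    cases hfind : Nat.find hex with
    | zero => rw [hfind, hplay.1, h0] at hd; exact absurd rfl hd
    | succ i =>
      rw [hfind] at hd
      have heq : ∀ j ≤ i, ρ' j = ρ j := fun j hj => by
        have := hmin j (by omega)
        push Not at this
        exact this
      -- only `p` deviates from `σ`, so the first departure from `ρ` is a move of `p`
      have howner : G.owner (ρ i) = p := by
        by_contra hp
        refine hd ?_
        have := out_update_succ (σ := σ) (p := p) (τ := τ) (i := i)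
          (by rw [← hρ', heq i le_rfl]; exact hp)
        rw [← hρ', heq i le_rfl, map_range_congr fun j hj => heq j (by omega), hmove] at this
        exact this
      rw [← infSet_shift ρ' i]
      refine hc p (ρ i) (hρZ i) (fun j => ρ' (i + j)) (heq i le_rfl) (fun j => hplay.2 (i + j)) ?_
      intro j hj hEj
      cases j with
      | zero => exact absurd ((congrArg G.owner (heq i le_rfl)).trans howner) hj
      | succ j =>
        have hpun := punish_deviation (G := G) (c := c) heq hd
          (show i + 1 < i + (j + 1) + 1 by omega)
        rw [howner, show i + (j + 1) + 1 - i = j + 1 + 1 by omega, map_range_succ] at hpun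
        have hst := out_update_succ (σ := σ) (p := p) (τ := τ) (i := i + (j + 1)) hj
        rw [← hρ', Strategy.ofChoice_move (by rw [hpun]; exact hEj), hpun] at hst
        exact hst

end GameArena

/-! ### Families of sets defined by the objective classes -/

/-- The sets of vertices that satisfy the Rabin condition given by the pair `(R, Q)`. -/
def IsRabinPair {V : Type} (R Q S : Set V) : Prop := (∀ v ∈ S, v ∉ R) ∧ ∃ v ∈ S, v ∈ Q

/-- The families `𝒜` of sets such that "the set of vertices occurring infinitely often is in `𝒜`" is
a condition of the class. For Rabin conditions, all the pairs that are sound for `𝒜` may be used;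
Streett conditions are the complements of Rabin conditions. -/
def ObjectiveClass.IsFamily {V : Type} (C : ObjectiveClass) (𝒜 : Set (Set V)) : Prop :=
  match C with
  | .buchi => ∃ U : Set V, ∀ S, S ∈ 𝒜 ↔ ∃ v, v ∈ S ∧ v ∈ U
  | .coBuchi => ∃ U : Set V, ∀ S, S ∈ 𝒜 ↔ ¬ ∃ v, v ∈ S ∧ v ∈ U
  | .parity => ∃ c : V → ℕ, ∀ S, S ∈ 𝒜 ↔ ∃ v ∈ S, (∀ w ∈ S, c w ≤ c v) ∧ Even (c v)
  | .rabin => ∀ S ∈ 𝒜, ∃ R Q, IsRabinPair R Q S ∧ ∀ S', IsRabinPair R Q S' → S' ∈ 𝒜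
  | .streett => ∀ S, S ∉ 𝒜 → ∃ R Q, IsRabinPair R Q S ∧ ∀ S', IsRabinPair R Q S' → S' ∉ 𝒜
  | .muller => True

theorem isRabinPair_iff {V : Type} {R Q S : Set V} :
    IsRabinPair R Q S ↔ S ∩ R = ∅ ∧ (S ∩ Q).Nonempty := by
  rw [IsRabinPair, ← Set.disjoint_iff_inter_eq_empty, Set.disjoint_left]
  rfl

theorem not_isRabinPair_iff {V : Type} {R Q S : Set V} :
    ¬ IsRabinPair R Q S ↔ (S ∩ R).Nonempty ∨ S ∩ Q = ∅ := by
  rw [isRabinPair_iff, ← Set.not_nonempty_iff_eq_empty, ← Set.not_nonempty_iff_eq_empty]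
  tauto

/-- All the pairs that are sound for `𝒜` together form a Rabin condition. -/
theorem exists_rabin_list {V : Type} [Finite V] {𝒜 : Set (Set V)}
    (h : ∀ S ∈ 𝒜, ∃ R Q, IsRabinPair R Q S ∧ ∀ S', IsRabinPair R Q S' → S' ∈ 𝒜) :
    ∃ L : List (Finset V × Finset V), ∀ S, S ∈ 𝒜 ↔ ∃ q ∈ L, IsRabinPair (↑q.1) (↑q.2) S := by
  classical
  have := Fintype.ofFinite V
  refine ⟨(Finset.univ.filter fun q : Finset V × Finset V =>
    ∀ S', IsRabinPair (↑q.1) (↑q.2) S' → S' ∈ 𝒜).toList, fun S => ⟨fun hS => ?_, ?_⟩⟩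
  · obtain ⟨R, Q, hS, hall⟩ := h S hS
    exact ⟨(R.toFinset, Q.toFinset), by simpa using hall, by simpa using hS⟩
  · rintro ⟨q, hq, hS⟩
    rw [Finset.mem_toList, Finset.mem_filter] at hq
    exact hq.2 S hS

theorem ObjectiveClass.mem_objectives_iff {V : Type} [Finite V] (C : ObjectiveClass)
    (X O : Set (ℕ → V)) :
    O ∈ C.objectives X ↔ ∃ 𝒜, C.IsFamily 𝒜 ∧ O = {ρ ∈ X | infSet ρ ∈ 𝒜} := by
  classical
  have := Fintype.ofFinite V
  cases C with
  | buchi =>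
    constructor
    · rintro ⟨U, rfl⟩
      exact ⟨{S | (S ∩ ↑U).Nonempty}, ⟨↑U, fun S => Iff.rfl⟩, rfl⟩
    · rintro ⟨𝒜, ⟨U, hU⟩, rfl⟩
      refine ⟨U.toFinset, ?_⟩
      ext ρ
      simp only [_root_.buchi, Set.coe_toFinset, Set.mem_ofPred_eq, hU]
      rfl
  | coBuchi =>
    constructor
    · rintro ⟨U, rfl⟩
      refine ⟨{S | S ∩ ↑U = ∅}, ⟨↑U, fun S => ?_⟩, rfl⟩
      rw [Set.mem_ofPred_eq, ← Set.not_nonempty_iff_eq_empty]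
      rfl
    · rintro ⟨𝒜, ⟨U, hU⟩, rfl⟩
      refine ⟨U.toFinset, ?_⟩
      ext ρ
      simp only [_root_.coBuchi, Set.coe_toFinset, Set.mem_ofPred_eq, hU,
        ← Set.not_nonempty_iff_eq_empty]
      rfl
  | parity =>
    constructor
    · rintro ⟨c, rfl⟩
      exact ⟨{S | ∃ v ∈ S, (∀ w ∈ S, c w ≤ c v) ∧ Even (c v)}, ⟨c, fun S => Iff.rfl⟩, rfl⟩
    · rintro ⟨𝒜, ⟨c, hc⟩, rfl⟩
      refine ⟨c, ?_⟩
      ext ρ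
      simp only [_root_.parity, Set.mem_ofPred_eq, hc]
  | rabin =>
    constructor
    · rintro ⟨L, rfl⟩
      refine ⟨{S | ∃ q ∈ L, S ∩ ↑q.1 = ∅ ∧ (S ∩ ↑q.2).Nonempty}, ?_, rfl⟩
      rintro S ⟨q, hq, hS⟩
      exact ⟨↑q.1, ↑q.2, isRabinPair_iff.2 hS, fun S' hS' => ⟨q, hq, isRabinPair_iff.1 hS'⟩⟩
    · rintro ⟨𝒜, h𝒜, rfl⟩
      obtain ⟨L, hL⟩ := exists_rabin_list h𝒜
      refine ⟨L, ?_⟩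
      ext ρ
      simp only [_root_.rabin, Set.mem_ofPred_eq, hL, isRabinPair_iff]
  | streett =>
    constructor
    · rintro ⟨L, rfl⟩
      refine ⟨{S | ∀ q ∈ L, (S ∩ ↑q.1).Nonempty ∨ S ∩ ↑q.2 = ∅}, ?_, rfl⟩
      intro S hS
      simp only [Set.mem_ofPred_eq, not_forall, ← not_isRabinPair_iff, not_not] at hS
      obtain ⟨q, hq, hS⟩ := hS
      exact ⟨↑q.1, ↑q.2, hS, fun S' hS' h => not_isRabinPair_iff.2 (h q hq) hS'⟩
    · rintro ⟨𝒜, h𝒜, rfl⟩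
      obtain ⟨L, hL⟩ := exists_rabin_list (𝒜 := 𝒜ᶜ) h𝒜
      have hL' : ∀ S, S ∈ 𝒜 ↔ ∀ q ∈ L, ¬ IsRabinPair (↑q.1) (↑q.2) S := by
        intro S
        have := not_congr (hL S)
        rw [Set.mem_compl_iff, not_not] at this
        rw [this]
        push Not
        rfl
      refine ⟨L, ?_⟩
      ext ρ
      simp only [_root_.streett, Set.mem_ofPred_eq, hL', not_isRabinPair_iff]
  | muller =>
    constructor
    · rintro ⟨F, rfl⟩
      exact ⟨{S | ∃ T ∈ F, (↑T : Set V) = S}, trivial, rfl⟩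
    · rintro ⟨𝒜, -, rfl⟩
      refine ⟨Finset.univ.filter fun T : Finset V => (↑T : Set V) ∈ 𝒜, ?_⟩
      ext ρ
      simp only [_root_.muller, Set.mem_ofPred_eq, Finset.mem_filter, Finset.mem_univ, true_and]
      refine and_congr_right fun _ => ⟨?_, fun h => ⟨(infSet ρ).toFinset, by simpa using h⟩⟩
      rintro ⟨T, hT, h⟩
      rwa [← h]

/-- Finitely many colors suffice: ranking the colors and keeping their parity changes nothing. -/
theorem exists_bounded_coloring {n : ℕ} {𝒜 : Set (Set (Fin n))} :
    ObjectiveClass.parity.IsFamily 𝒜 ↔ ∃ c : Fin n → Fin (2 * n), ∀ S, S ∈ 𝒜 ↔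
      ∃ v, v ∈ S ∧ (∀ w, w ∈ S → (c w : ℕ) ≤ c v) ∧ (c v : ℕ) % 2 = 0 := by
  classical
  constructor
  · rintro ⟨c, hc⟩
    let r : Fin n → ℕ := fun v => (Finset.univ.filter fun w => c w < c v).card
    have hlt : ∀ v w, c w < c v → r w < r v := by
      intro v w h
      refine Finset.card_lt_card ((Finset.ssubset_iff_of_subset fun u hu => ?_).2 ⟨w, ?_, ?_⟩)
      · simp only [Finset.mem_filter, Finset.mem_univ, true_and] at hu ⊢
        omega
      · simpa using h
      · simp
    have hr : ∀ v, r v < n := by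
      intro v
      have : r v < (Finset.univ : Finset (Fin n)).card :=
        Finset.card_lt_card ((Finset.ssubset_iff_of_subset (Finset.subset_univ _)).2
          ⟨v, Finset.mem_univ v, by simp⟩)
      simpa using this
    have heq : ∀ v w, c w = c v → r w = r v := by
      intro v w h
      simp only [r, h]
    have hle : ∀ v w, 2 * r w + c w % 2 ≤ 2 * r v + c v % 2 ↔ c w ≤ c v := by
      intro v w
      rcases lt_trichotomy (c w) (c v) with h | h | h
      · have := hlt v w h; omega
      · have := heq v w h; omega
      · have := hlt w v h; omega
    refine ⟨fun v => ⟨2 * r v + c v % 2, by have := hr v; omega⟩, fun S => ?_⟩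
    simp only [hc, hle, Nat.even_iff]
    refine exists_congr fun v => and_congr_right fun _ => and_congr_right fun _ => ?_
    omega
  · rintro ⟨c, hc⟩
    refine ⟨fun v => c v, fun S => ?_⟩
    rw [hc]
    simp only [Nat.even_iff]

namespace GameArena

open MullerGame

variable {P V : Type} {G : GameArena P V}

/-! ### Equilibria as Muller games -/

/-- Whether the objective "the infinity set is in `𝒜`" is a possible objective of `p` when the
outcome has the infinity set `S` and the true objective of `p` is given by the family `W p`. -/
def IsCandidate (G : GameArena P V) (W : P → Set (Set V)) (knw : Knowledge) (p : P)
    (𝒜 : Set (Set V)) (S : Set V) : Prop :=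
  match knw with
  | .pw => (S ∈ 𝒜 ∧ S ∈ W p) ∨ (S ∉ 𝒜 ∧ S ∉ W p)
  | .gw => (S ∈ W p ∧ WinsFrom G.Edge Set.univ 𝒜 Set.univ G.init) ∨
      (S ∉ W p ∧ ¬ WinsFrom G.Edge {v | G.owner v = p} 𝒜 Set.univ G.init)
  | .pg => S ∈ 𝒜 ∨ (S ∉ 𝒜 ∧ ¬ WinsFrom G.Edge {v | G.owner v = p} 𝒜 Set.univ G.init)
  | .pgw => (S ∈ 𝒜 ∧ S ∈ W p) ∨
      (S ∉ 𝒜 ∧ S ∉ W p ∧ ¬ WinsFrom G.Edge {v | G.owner v = p} 𝒜 Set.univ G.init)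

/-- The infinity sets that a deviation of `p` may have when the outcome has the infinity
set `S`. -/
def tolerated (G : GameArena P V) (W : P → Set (Set V)) (knw : Knowledge) (C : ObjectiveClass)
    (p : P) (S : Set V) : Set (Set V) :=
  {S' | (∀ 𝒜, C.IsFamily 𝒜 → G.IsCandidate W knw p 𝒜 S' → G.IsCandidate W knw p 𝒜 S) ∧
    (S' ∈ W p → S ∈ W p)}

/-- The sets of strings among which the candidates are formed. -/
def strings (G : GameArena P V) : Knowledge → Set (ℕ → V)
  | .pw => Set.univ
  | _ => G.plays

theorem candidates_eq (knw : Knowledge) (C : ObjectiveClass) :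
    G.candidates knw C = C.objectives (G.strings knw) := by
  cases knw <;> rfl

/-- Membership in the set of possible objectives depends only on the infinity set of the outcome. -/
theorem mem_obj_iff [Finite V] (hG : G.NonBlocking) {W : P → Set (Set V)} {knw : Knowledge}
    {Ω : Set (Set (ℕ → V))} {p : P} {σ : G.Profile} {𝒜 : Set (Set V)}
    (hΩ : {ρ ∈ G.strings knw | infSet ρ ∈ 𝒜} ∈ Ω) :
    {ρ ∈ G.strings knw | infSet ρ ∈ 𝒜} ∈
        obj knw Ω (fun p => {ρ ∈ G.plays | infSet ρ ∈ W p}) p σ ↔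
      G.IsCandidate W knw p 𝒜 (infSet σ.out) := by
  have hout := σ.out_mem_plays hG
  have hw : p ∈ winners σ (fun p => {ρ ∈ G.plays | infSet ρ ∈ W p}) ↔ infSet σ.out ∈ W p :=
    and_iff_right hout
  have hne : {ρ ∈ G.plays | infSet ρ ∈ 𝒜} ≠ ∅ ↔
      WinsFrom G.Edge Set.univ 𝒜 Set.univ G.init := by
    rw [← Set.nonempty_iff_ne_empty, winsFrom_univ_iff]
    constructor
    · rintro ⟨ρ, hρ, h⟩
      exact ⟨ρ, hρ.1, hρ.2, fun _ => Set.mem_univ _, h⟩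
    · rintro ⟨ρ, h0, hE, -, h⟩
      exact ⟨ρ, ⟨h0, hE⟩, h⟩
  have hO : ∀ X : Set (ℕ → V), σ.out ∈ X → (σ.out ∈ {ρ ∈ X | infSet ρ ∈ 𝒜} ↔ infSet σ.out ∈ 𝒜) :=
    fun X hX => and_iff_right hX
  cases knw with
  | pw =>
    refine (and_iff_right hΩ).trans ?_
    simp only [strings, hw, hO _ (Set.mem_univ _), IsCandidate]
  | gw =>
    refine (and_iff_right hΩ).trans ?_
    simp only [strings, hw, hne, IsCandidate, mem_winnable_iff hG]
  | pg =>
    refine (and_iff_right hΩ).trans ?_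
    simp only [strings, hO _ hout, IsCandidate, mem_winnable_iff hG]
  | pgw =>
    refine (and_iff_right hΩ).trans ?_
    simp only [strings, hw, hO _ hout, IsCandidate, mem_winnable_iff hG]

/-- The equilibrium conditions ask that the infinity set of every deviation is tolerated. -/
theorem exists_isOINE_iff [Finite V] [DecidableEq P] (hG : G.NonBlocking) (W : P → Set (Set V))
    (knw : Knowledge) (C : ObjectiveClass) :
    (∃ σ : G.Profile,
      IsOINE knw (G.candidates knw C) (fun p => {ρ ∈ G.plays | infSet ρ ∈ W p}) σ) ↔
    ∃ S Z : Set V, WinsFrom G.Edge Set.univ {S} Z G.init ∧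
      ∀ p, ∀ v ∈ Z, WinsFrom G.Edge {v | G.owner v ≠ p} (G.tolerated W knw C p S) Set.univ v := by
  rw [← exists_profile_iff hG (𝒢 := G.tolerated W knw C) fun p S => ⟨fun _ _ h => h, id⟩]
  refine exists_congr fun σ => ?_
  rw [IsOINE, IsOIE, IsNash, ← forall_and]
  refine forall_congr' fun p => ?_
  rw [← forall_and]
  refine forall_congr' fun τ => and_congr ?_ ?_
  · rw [candidates_eq]
    constructor
    · intro h 𝒜 h𝒜 hc
      have hΩ : {ρ ∈ G.strings knw | infSet ρ ∈ 𝒜} ∈ C.objectives (G.strings knw) :=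
        (C.mem_objectives_iff _ _).2 ⟨𝒜, h𝒜, rfl⟩
      exact (mem_obj_iff hG hΩ).1 (h ((mem_obj_iff hG hΩ).2 hc))
    · intro h O hO
      have hΩ : O ∈ C.objectives (G.strings knw) := by
        cases knw <;> exact hO.1
      obtain ⟨𝒜, h𝒜, rfl⟩ := (C.mem_objectives_iff _ _).1 hΩ
      exact (mem_obj_iff hG hΩ).2 (h 𝒜 h𝒜 ((mem_obj_iff hG hΩ).1 hO))
  · have hw : ∀ σ : G.Profile, p ∈ winners σ (fun p => {ρ ∈ G.plays | infSet ρ ∈ W p}) ↔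
        infSet σ.out ∈ W p := fun σ => and_iff_right (σ.out_mem_plays hG)
    rw [hw, hw]

/-- When all sets of infinite strings are candidates and the adversary knows the play and the
winners, a profile is an equilibrium only if no deviation changes its outcome. -/
theorem isOINE_pw_univ_iff [DecidableEq P] {α : P → Set (ℕ → V)} {σ : G.Profile} :
    IsOINE .pw Set.univ α σ ↔
      ∀ (p : P) (τ : G.Strategy p), Profile.out (Function.update σ p τ) = σ.out := by
  constructor
  · rintro ⟨h, -⟩ p τ
    by_contra hne
    set ρ' := Profile.out (Function.update σ p τ)
    -- a candidate that fits the deviation, and does not fit the outcome of `σ`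
    let O : Set (ℕ → V) := {ρ | (ρ = ρ' ∧ ρ' ∈ α p) ∨ (ρ = σ.out ∧ σ.out ∉ α p)}
    have h1 : ρ' ∈ O ↔ ρ' ∈ α p := by simp [O, hne]
    have h2 : σ.out ∈ O ↔ σ.out ∉ α p := by simp [O, Ne.symm hne]
    have hO : O ∈ obj .pw Set.univ α p (Function.update σ p τ) := by
      refine ⟨Set.mem_univ _, ?_⟩
      change (ρ' ∈ O ∧ ρ' ∈ α p) ∨ (ρ' ∉ O ∧ ρ' ∉ α p)
      tauto
    have := (h p τ hO).2
    change (σ.out ∈ O ∧ σ.out ∈ α p) ∨ (σ.out ∉ O ∧ σ.out ∉ α p) at this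
    tauto
  · intro h
    refine ⟨fun p τ O hO => ?_, fun p τ hw => ?_⟩
    · simpa only [obj, winners, h p τ] using hO
    · simpa only [winners, Set.mem_ofPred_eq, h p τ] using hw

/-- The outcome cannot be changed if and only if every vertex on it has only one successor. -/
theorem exists_isOINE_pw_univ_iff [DecidableEq P] (hG : G.NonBlocking) (α : P → Set (ℕ → V)) :
    (∃ σ : G.Profile, IsOINE .pw Set.univ α σ) ↔
      ∃ B : Set V, G.init ∈ B ∧
        ∀ v ∈ B, ∀ w, G.Edge v w → w ∈ B ∧ ∀ w', G.Edge v w' → w' = w := by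
  simp only [isOINE_pw_univ_iff]
  constructor
  · rintro ⟨σ, hσ⟩
    have hout := σ.out_mem_plays hG
    have huniq : ∀ i w, G.Edge (σ.out i) w → w = σ.out (i + 1) := by
      intro i w hw
      let c : List V → V := fun l => if l.length = i + 1 then w else σ.out l.length
      let τ := Strategy.ofChoice G (G.owner (σ.out i)) c
      have hc : c ((List.range i).map σ.out ++ [σ.out i]) = w := by simp [c]
      have h1 := Profile.out_succ (Function.update σ (G.owner (σ.out i)) τ) i
      rw [hσ, Function.update_self, Strategy.ofChoice_move (by rw [hc]; exact hw), hc] at h1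
      exact h1.symm
    refine ⟨Set.range σ.out, ⟨0, rfl⟩, ?_⟩
    rintro _ ⟨i, rfl⟩ w hw
    have := huniq i w hw
    exact ⟨⟨i + 1, this.symm⟩, fun w' hw' => (huniq i w' hw').trans this.symm⟩
  · rintro ⟨B, hB, h⟩
    refine ⟨fun p => Strategy.ofChoice G p fun _ => G.init, fun p τ => ?_⟩
    set σ : G.Profile := fun p => Strategy.ofChoice G p fun _ => G.init
    have h1 := σ.out_mem_plays hG
    have h2 := Profile.out_mem_plays hG (Function.update σ p τ)
    have hmem : ∀ i, σ.out i ∈ B := by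
      intro i
      induction i with
      | zero => rw [h1.1]; exact hB
      | succ i ih => exact (h _ ih _ (h1.2 i)).1
    funext i
    induction i with
    | zero => rw [h1.1, h2.1]
    | succ i ih =>
      have h3 := h2.2 i
      rw [ih] at h3
      exact (h _ (hmem i) _ (h1.2 i)).2 _ h3

end GameArena

/-! ### Finite types with numerical codes -/

/-- A finite type whose elements are numbered. -/
class Numbered (τ : Type) where
  card : ℕ
  equiv : τ ≃ Fin card

namespace Numbered

/-- The number of an element. -/
def code {τ : Type} [Numbered τ] (t : τ) : ℕ := equiv t

theorem code_lt {τ : Type} [Numbered τ] (t : τ) : code t < card τ := (equiv t).2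

theorem code_inj {τ : Type} [Numbered τ] {s t : τ} : code s = code t ↔ s = t := by
  rw [code, code, Fin.val_inj, equiv.injective.eq_iff]

theorem exists_code_eq {τ : Type} [Numbered τ] {m : ℕ} (hm : m < card τ) : ∃ t : τ, code t = m :=
  ⟨equiv.symm ⟨m, hm⟩, by simp [code]⟩

instance (n : ℕ) : Numbered (Fin n) := ⟨n, Equiv.refl _⟩

instance (n m : ℕ) : Numbered (Fin n → Fin m) := ⟨m ^ n, finFunctionFinEquiv⟩

theorem val_eq_code {n m : ℕ} (c : Fin n → Fin m) (v : Fin n) :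
    (c v : ℕ) = code c / m ^ code v % m := by
  have h : finFunctionFinEquiv.symm (finFunctionFinEquiv c) v = c v := by simp
  conv_lhs => rw [← h]
  rfl

open Classical in
/-- Sets correspond to bit vectors. -/
noncomputable def setEquiv (τ : Type) [Numbered τ] : Set τ ≃ (Fin (card τ) → Fin 2) where
  toFun S i := if equiv.symm i ∈ S then 1 else 0
  invFun f := {t | f (equiv t) = 1}
  left_inv S := by ext t; simp
  right_inv f := by
    funext i
    have : f i = 0 ∨ f i = 1 := by generalize f i = x; revert x; decide
    rcases this with h | h <;> simp [h]

/-- A set is numbered by its bit vector. -/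
noncomputable instance (τ : Type) [Numbered τ] : Numbered (Set τ) :=
  ⟨2 ^ card τ, (setEquiv τ).trans finFunctionFinEquiv⟩

theorem mem_iff_code {τ : Type} [Numbered τ] {t : τ} {S : Set τ} :
    t ∈ S ↔ code S / 2 ^ code t % 2 = 1 := by
  classical
  have h : ((setEquiv τ S (equiv t) : Fin 2) : ℕ) = code S / 2 ^ code t % 2 :=
    val_eq_code (setEquiv τ S) (equiv t)
  rw [← h]
  by_cases ht : t ∈ S <;> simp [setEquiv, ht]

end Numbered

open Numbered

/-! ### Uniform primitive recursion -/

/-- A function of the elements of `Γ` can be computed, by a primitive recursive function, from the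
codes `e g` of the elements `g`. -/
def Rec {Γ ι β : Type} [Primcodable ι] [Primcodable β] (e : Γ → ι) (f : Γ → β) : Prop :=
  ∃ f' : ι → β, Primrec f' ∧ ∀ g, f g = f' (e g)

/-- A property of the elements of `Γ` can be recognized primitive recursively from their codes. -/
def Recog {Γ ι : Type} [Primcodable ι] (e : Γ → ι) (p : Γ → Prop) : Prop :=
  ∃ q : ι → Prop, PrimrecPred q ∧ ∀ g, p g ↔ q (e g)

/-- The code of an element `g` of `Γ` together with an element of a numbered type that depends
on `g`. -/
def extend {Γ ι : Type} {T : Γ → Type} [∀ g, Numbered (T g)] (e : Γ → ι) : (Σ g, T g) → ι × ℕ :=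
  fun x => (e x.1, code x.2)

section closure

variable {Γ ι : Type} [Primcodable ι] {e : Γ → ι} {T : Γ → Type} [∀ g, Numbered (T g)]
variable {β γ δ : Type} [Primcodable β] [Primcodable γ] [Primcodable δ]

theorem Rec.comp {f : Γ → β} (h : Rec e f) {k : β → γ} (hk : Primrec k) :
    Rec e fun g => k (f g) := by
  obtain ⟨f', hf', h⟩ := h
  exact ⟨fun x => k (f' x), hk.comp hf', fun g => by simp only [h]⟩

theorem Rec.comp₂ {f : Γ → β} {f₂ : Γ → γ} (h : Rec e f) (h₂ : Rec e f₂) {k : β → γ → δ}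
    (hk : Primrec₂ k) : Rec e fun g => k (f g) (f₂ g) := by
  obtain ⟨f', hf', h⟩ := h
  obtain ⟨f₂', hf₂', h₂⟩ := h₂
  exact ⟨fun x => k (f' x) (f₂' x), hk.comp hf' hf₂', fun g => by simp only [h, h₂]⟩

theorem Rec.const (b : β) : Rec e fun _ => b := ⟨fun _ => b, Primrec.const b, fun _ => rfl⟩

theorem Rec.lift {f : Γ → β} (h : Rec e f) :
    Rec (extend e) fun x : Σ g, T g => f x.1 := by
  obtain ⟨f', hf', h⟩ := h
  exact ⟨fun x => f' x.1, hf'.comp Primrec.fst, fun x => h x.1⟩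

theorem Rec.var : Rec (extend e) fun x : Σ g, T g => code x.2 :=
  ⟨Prod.snd, Primrec.snd, fun _ => rfl⟩

theorem primrec_pow : Primrec₂ ((· ^ ·) : ℕ → ℕ → ℕ) := Primrec₂.unpaired'.1 Nat.Primrec.pow

theorem Rec.card_set (h : Rec e fun g => card (T g)) : Rec e fun g => card (Set (T g)) :=
  (Rec.const 2).comp₂ h primrec_pow

theorem Recog.congr {p q : Γ → Prop} (h : Recog e q) (hpq : ∀ g, p g ↔ q g) : Recog e p := by
  rwa [show p = q from funext fun g => propext (hpq g)]

theorem Recog.const (p : Prop) : Recog e fun _ => p := by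
  classical
  exact ⟨fun _ => p, ⟨fun _ => inferInstance, Primrec.const _⟩, fun _ => Iff.rfl⟩

theorem Recog.comp₂ {f : Γ → β} {f₂ : Γ → γ} (h : Rec e f) (h₂ : Rec e f₂) {p : β → γ → Prop}
    (hp : PrimrecRel p) : Recog e fun g => p (f g) (f₂ g) := by
  obtain ⟨f', hf', h⟩ := h
  obtain ⟨f₂', hf₂', h₂⟩ := h₂
  exact ⟨fun x => p (f' x) (f₂' x), hp.comp hf' hf₂', fun g => by simp only [h, h₂]⟩

theorem Recog.not {p : Γ → Prop} (h : Recog e p) : Recog e fun g => ¬ p g := by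
  obtain ⟨p', hp', h⟩ := h
  exact ⟨_, hp'.not, fun g => not_congr (h g)⟩

theorem Recog.and {p q : Γ → Prop} (h : Recog e p) (h₂ : Recog e q) :
    Recog e fun g => p g ∧ q g := by
  obtain ⟨p', hp', h⟩ := h
  obtain ⟨q', hq', h₂⟩ := h₂
  exact ⟨_, hp'.and hq', fun g => and_congr (h g) (h₂ g)⟩

theorem Recog.or {p q : Γ → Prop} (h : Recog e p) (h₂ : Recog e q) :
    Recog e fun g => p g ∨ q g := by
  obtain ⟨p', hp', h⟩ := h
  obtain ⟨q', hq', h₂⟩ := h₂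
  exact ⟨_, hp'.or hq', fun g => or_congr (h g) (h₂ g)⟩

theorem Recog.imp {p q : Γ → Prop} (h : Recog e p) (h₂ : Recog e q) :
    Recog e fun g => p g → q g :=
  (h.not.or h₂).congr fun _ => imp_iff_not_or

theorem Recog.iff {p q : Γ → Prop} (h : Recog e p) (h₂ : Recog e q) :
    Recog e fun g => p g ↔ q g :=
  ((h.imp h₂).and (h₂.imp h)).congr fun _ => iff_iff_implies_and_implies

/-- A quantifier over a numbered type is a bounded quantifier over the codes. -/
theorem Recog.exists {p : ∀ g, T g → Prop} (hc : Rec e fun g => card (T g))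
    (h : Recog (extend e) fun x : Σ g, T g => p x.1 x.2) : Recog e fun g => ∃ t, p g t := by
  obtain ⟨b, hb, hc⟩ := hc
  obtain ⟨q, hq, h⟩ := h
  have hR : PrimrecRel fun (m : ℕ) (x : ι) => q (x, m) :=
    hq.comp (Primrec.pair Primrec.snd Primrec.fst)
  refine ⟨fun x => ∃ m ∈ List.range (b x), q (x, m),
    hR.exists_mem_list.comp (Primrec.list_range.comp hb) Primrec.id, fun g => ?_⟩
  constructor
  · rintro ⟨t, ht⟩
    exact ⟨code t, List.mem_range.2 (by rw [← hc]; exact code_lt t), (h ⟨g, t⟩).1 ht⟩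
  · rintro ⟨m, hm, hqm⟩
    rw [List.mem_range, ← hc] at hm
    obtain ⟨t, rfl⟩ := exists_code_eq hm
    exact ⟨t, (h ⟨g, t⟩).2 hqm⟩

theorem Recog.forall {p : ∀ g, T g → Prop} (hc : Rec e fun g => card (T g))
    (h : Recog (extend e) fun x : Σ g, T g => p x.1 x.2) : Recog e fun g => ∀ t, p g t :=
  (Recog.exists (p := fun g t => ¬ p g t) hc h.not).not.congr fun _ => not_exists_not.symm

theorem Recog.eq {s t : ∀ g, T g} (hs : Rec e fun g => code (s g))
    (ht : Rec e fun g => code (t g)) : Recog e fun g => s g = t g :=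
  (Recog.comp₂ hs ht Primrec.eq).congr fun _ => code_inj.symm

theorem primrecRel_testBit : PrimrecRel fun m i : ℕ => m / 2 ^ i % 2 = 1 :=
  Primrec.eq.comp
    (Primrec.nat_mod.comp (Primrec.nat_div.comp Primrec.fst
      (primrec_pow.comp (Primrec.const 2) Primrec.snd)) (Primrec.const 2))
    (Primrec.const 1)

theorem Recog.mem {t : ∀ g, T g} {S : ∀ g, Set (T g)} (ht : Rec e fun g => code (t g))
    (hS : Rec e fun g => code (S g)) : Recog e fun g => t g ∈ S g :=
  (Recog.comp₂ hS ht primrecRel_testBit).congr fun _ => mem_iff_code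

/-- The code of a set is found by a bounded search. -/
theorem Rec.set {S : ∀ g, Set (T g)} (hc : Rec e fun g => card (T g))
    (h : Recog (extend e) fun x : Σ g, T g => x.2 ∈ S x.1) : Rec e fun g => code (S g) := by
  classical
  have h' : Recog (extend e) fun x : Σ g, Set (T g) => x.2 = S x.1 := by
    refine Recog.congr (q := fun x : Σ g, Set (T g) => ∀ t, t ∈ x.2 ↔ t ∈ S x.1) ?_
      fun x => Set.ext_iff
    refine Recog.forall hc.lift (Recog.iff (.mem .var Rec.var.lift) ?_)
    obtain ⟨q, hq, h⟩ := h
    exact ⟨fun x => q (x.1.1, x.2), hq.comp (Primrec.pair (Primrec.fst.comp Primrec.fst)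
      Primrec.snd), fun x => h ⟨x.1.1, x.2⟩⟩
  obtain ⟨b, hb, hc⟩ := hc.card_set
  obtain ⟨q, hq, h'⟩ := h'
  have hR : PrimrecPred fun x : ι × ℕ => x.2 < b x.1 ∧ q x :=
    (Primrec.nat_lt.comp Primrec.snd (hb.comp Primrec.fst)).and hq
  refine ⟨fun x => (b x).findGreatest fun m => m < b x ∧ q (x, m),
    Primrec.nat_findGreatest hb hR.primrecRel, fun g => ?_⟩
  symm
  rw [Nat.findGreatest_eq_iff, ← hc]
  have hself : q (e g, code (S g)) := (h' ⟨g, S g⟩).1 rfl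
  refine ⟨(code_lt _).le, fun _ => ⟨code_lt _, hself⟩, fun m hm _ hqm => ?_⟩
  obtain ⟨S', rfl⟩ := exists_code_eq hqm.1
  have : S' = S g := (h' ⟨g, S'⟩).2 hqm.2
  rw [this] at hm
  exact lt_irrefl _ hm

end closure

open Numbered MullerGame

/-! ### The code of a game -/

/-- An arena with Muller conditions. -/
structure GameInstance where
  k : ℕ
  n : ℕ
  arena : GameArena (Fin k) (Fin n)
  cond : Fin k → List (Finset (Fin n))

namespace GameInstance

/-- The code of the game that the algorithm receives. -/
noncomputable def code (I : GameInstance) : GameCode := encodeGame I.arena I.cond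

/-- The infinity sets with which `p` wins. -/
def winSets (I : GameInstance) (p : Fin I.k) : Set (Set (Fin I.n)) :=
  {S | ∃ T ∈ I.cond p, (↑T : Set (Fin I.n)) = S}

end GameInstance

theorem getD_ofFn {α : Type} {n : ℕ} (f : Fin n → α) (i : Fin n) (d : α) :
    (List.ofFn f).getD i d = f i := by
  simp [List.getD]

section recognition

variable {Γ ι : Type} [Primcodable ι] {e : Γ → ι} {G : Γ → GameInstance}
  (hG : Rec e fun g => (G g).code)

include hG

theorem rec_card_player : Rec e fun g => card (Fin (G g).k) :=
  hG.comp Primrec.fst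

theorem rec_card_vertex : Rec e fun g => card (Fin (G g).n) :=
  hG.comp (Primrec.fst.comp Primrec.snd)

theorem rec_init : Rec e fun g => code (G g).arena.init :=
  hG.comp (Primrec.fst.comp (Primrec.snd.comp Primrec.snd))

theorem rec_owner {v : ∀ g, Fin (G g).n} (hv : Rec e fun g => code (v g)) :
    Rec e fun g => code ((G g).arena.owner (v g)) := by
  have h : Rec e fun g => ((G g).code.2.2.2.1).getD (code (v g)) 0 :=
    (hG.comp (Primrec.fst.comp (Primrec.snd.comp (Primrec.snd.comp Primrec.snd)))).comp₂ hv
      (Primrec.list_getD 0)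
  obtain ⟨f, hf, h⟩ := h
  refine ⟨f, hf, fun g => ?_⟩
  rw [← h]
  exact (getD_ofFn (fun v => ((G g).arena.owner v : ℕ)) (v g) 0).symm

theorem recog_edge {v w : ∀ g, Fin (G g).n} (hv : Rec e fun g => code (v g))
    (hw : Rec e fun g => code (w g)) :
    Recog e fun g => (G g).arena.Edge (v g) (w g) := by
  have h : Rec e fun g => (((G g).code.2.2.2.2.1).getD (code (v g)) []).getD
      (code (w g)) false :=
    (((hG.comp (Primrec.fst.comp (Primrec.snd.comp (Primrec.snd.comp (Primrec.snd.comp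
      Primrec.snd))))).comp₂ hv (Primrec.list_getD [])).comp₂ hw (Primrec.list_getD false))
  refine (Recog.comp₂ h (Rec.const true) Primrec.eq).congr fun g => ?_
  classical
  have h1 : ((G g).code.2.2.2.2.1).getD (code (v g)) [] =
      List.ofFn fun w => decide ((v g, w) ∈ (G g).arena.edges) :=
    (getD_ofFn _ (v g) _).trans (by congr! 2)
  rw [h1, show (List.ofFn fun w => decide ((v g, w) ∈ (G g).arena.edges)).getD (code (w g)) false =
    decide ((v g, w g) ∈ (G g).arena.edges) from getD_ofFn _ (w g) _, decide_eq_true_iff]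
  rfl

theorem recog_winSets {p : ∀ g, Fin (G g).k} (hp : Rec e fun g => code (p g))
    {S : ∀ g, Set (Fin (G g).n)} (hS : Rec e fun g => code (S g)) :
    Recog e fun g => S g ∈ (G g).winSets (p g) := by
  obtain ⟨L, hL, hL'⟩ : Rec e fun g =>
      ((G g).code.2.2.2.2.2).getD (code (p g)) [] :=
    (hG.comp (Primrec.snd.comp (Primrec.snd.comp (Primrec.snd.comp (Primrec.snd.comp
      Primrec.snd))))).comp₂ hp (Primrec.list_getD [])
  obtain ⟨n, hn, hn'⟩ := rec_card_vertex hG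
  obtain ⟨s, hs, hs'⟩ := hS
  have h1 : PrimrecRel fun (i : ℕ) (x : List Bool × ι) =>
      x.1.getD i false = true ↔ s x.2 / 2 ^ i % 2 = 1 := by
    have ha : PrimrecPred fun y : ℕ × List Bool × ι => y.2.1.getD y.1 false = true :=
      Primrec.eq.comp ((Primrec.list_getD false).comp (Primrec.fst.comp Primrec.snd) Primrec.fst)
        (Primrec.const true)
    have hb : PrimrecPred fun y : ℕ × List Bool × ι => s y.2.2 / 2 ^ y.1 % 2 = 1 :=
      primrecRel_testBit.comp (hs.comp (Primrec.snd.comp Primrec.snd)) Primrec.fst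
    exact ((ha.and hb).or (ha.not.and hb.not)).of_eq fun y => by tauto
  have h2 : PrimrecRel fun (l : List Bool) (x : ι) =>
      ∀ i ∈ List.range (n x), (l.getD i false = true ↔ s x / 2 ^ i % 2 = 1) :=
    h1.forall_mem_list.comp (Primrec.list_range.comp (hn.comp Primrec.snd)) Primrec.id
  refine ⟨fun x => ∃ l ∈ L x, ∀ i ∈ List.range (n x),
    (l.getD i false = true ↔ s x / 2 ^ i % 2 = 1),
    h2.exists_mem_list.comp hL Primrec.id, fun g => ?_⟩
  simp only [← hL', ← hn', ← hs']
  classical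
  have hcode : ((G g).code.2.2.2.2.2).getD (code (p g)) [] =
      ((G g).cond (p g)).map fun S => List.ofFn fun v => decide (v ∈ S) := by
    refine (getD_ofFn _ (p g) _).trans ?_
    congr! 3
  rw [hcode]
  have hT : ∀ T : Finset (Fin (G g).n), (↑T : Set (Fin (G g).n)) = S g ↔
      ∀ i ∈ List.range (card (Fin (G g).n)), ((List.ofFn fun v => decide (v ∈ T)).getD i false =
        true ↔ code (S g) / 2 ^ i % 2 = 1) := by
    intro T
    rw [Set.ext_iff]
    constructor
    · intro h i hi
      have := h ⟨i, List.mem_range.1 hi⟩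
      rw [Finset.mem_coe, mem_iff_code] at this
      rw [show (List.ofFn fun v => decide (v ∈ T)).getD i false =
          decide (⟨i, List.mem_range.1 hi⟩ ∈ T)
        from getD_ofFn _ ⟨i, List.mem_range.1 hi⟩ _, decide_eq_true_iff]
      exact this
    · intro h v
      have := h v (List.mem_range.2 v.2)
      rw [getD_ofFn, decide_eq_true_iff] at this
      rw [Finset.mem_coe, mem_iff_code]
      exact this
  simp only [GameInstance.winSets, List.mem_map, exists_exists_and_eq_and]
  exact exists_congr fun T => and_congr_right fun _ => hT T

theorem recog_subset {X Y : ∀ g, Set (Fin (G g).n)} (hX : Rec e fun g => code (X g))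
    (hY : Rec e fun g => code (Y g)) : Recog e fun g => X g ⊆ Y g :=
  Recog.congr (q := fun g => ∀ v, v ∈ X g → v ∈ Y g)
    (.forall (rec_card_vertex hG) (.imp (.mem .var hX.lift) (.mem .var hY.lift))) fun _ => Iff.rfl

theorem rec_compl {A : ∀ g, Set (Fin (G g).n)} (hA : Rec e fun g => code (A g)) :
    Rec e fun g => code (A g)ᶜ :=
  .set (rec_card_vertex hG) (Recog.mem .var hA.lift).not

theorem rec_univ : Rec e fun g => code (Set.univ : Set (Fin (G g).n)) :=
  .set (rec_card_vertex hG) ((Recog.const True).congr fun _ => iff_true_intro trivial)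

theorem rec_singleton {v : ∀ g, Fin (G g).n} (hv : Rec e fun g => code (v g)) :
    Rec e fun g => code ({v g} : Set (Fin (G g).n)) :=
  .set (rec_card_vertex hG) (Recog.eq (T := fun x : Σ g, Fin (G g).n => Fin (G x.1).n) .var hv.lift)

theorem rec_singleton_set {S : ∀ g, Set (Fin (G g).n)} (hS : Rec e fun g => code (S g)) :
    Rec e fun g => code ({S g} : Set (Set (Fin (G g).n))) :=
  .set (rec_card_vertex hG).card_set
    (Recog.eq (T := fun x : Σ g, Set (Fin (G g).n) => Set (Fin (G x.1).n)) .var hS.lift)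

theorem rec_owned {p : ∀ g, Fin (G g).k} (hp : Rec e fun g => code (p g)) :
    Rec e fun g => code {v | (G g).arena.owner v = p g} :=
  .set (rec_card_vertex hG)
    (Recog.eq (T := fun x : Σ g, Fin (G g).n => Fin (G x.1).k) (rec_owner hG.lift .var) hp.lift)

/-! ### Recognizing winning -/

section

variable {A X Y Z : ∀ g, Set (Fin (G g).n)} {𝒜 : ∀ g, Set (Set (Fin (G g).n))}
  {v : ∀ g, Fin (G g).n}

theorem recog_attrClosed (hA : Rec e fun g => code (A g))
    (hX : Rec e fun g => code (X g)) (hY : Rec e fun g => code (Y g)) :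
    Recog e fun g => AttrClosed (G g).arena.Edge (A g) (X g) (Y g) := by
  have hc := rec_card_vertex hG
  unfold AttrClosed
  refine .forall hc (.imp (.mem .var hX.lift) (.imp (.or (.and (.mem .var hA.lift) ?_)
    (.and (Recog.mem .var hA.lift).not ?_)) (.mem .var hY.lift)))
  · exact .exists hc.lift (.and (.mem .var hX.lift.lift)
      (.and (recog_edge hG.lift.lift Rec.var.lift .var) (.mem .var hY.lift.lift)))
  · exact .forall hc.lift (.imp (.mem .var hX.lift.lift)
      (.imp (recog_edge hG.lift.lift Rec.var.lift .var) (.mem .var hY.lift.lift)))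

theorem recog_mem_attr (hA : Rec e fun g => code (A g))
    (hX : Rec e fun g => code (X g)) (hZ : Rec e fun g => code (Z g))
    (hv : Rec e fun g => code (v g)) :
    Recog e fun g => v g ∈ attr (G g).arena.Edge (A g) (X g) (Z g) :=
  Recog.forall (p := fun g B => Z g ⊆ B → AttrClosed (G g).arena.Edge (A g) (X g) B → v g ∈ B)
    (rec_card_vertex hG).card_set (.imp (recog_subset hG.lift hZ.lift .var)
      (.imp (recog_attrClosed hG.lift hA.lift hX.lift .var) (.mem hv.lift .var)))

theorem recog_isArena (hX : Rec e fun g => code (X g)) :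
    Recog e fun g => IsArena (G g).arena.Edge (X g) := by
  have hc := rec_card_vertex hG
  unfold IsArena
  exact .forall hc (.imp (.mem .var hX.lift) (.exists hc.lift (.and (.mem .var hX.lift.lift)
    (recog_edge hG.lift.lift Rec.var.lift .var))))

theorem recog_isTrap (hA : Rec e fun g => code (A g))
    (hX : Rec e fun g => code (X g)) (hY : Rec e fun g => code (Y g)) :
    Recog e fun g => IsTrap (G g).arena.Edge (A g) (X g) (Y g) := by
  have hc := rec_card_vertex hG
  unfold IsTrap
  exact .forall hc (.imp (.mem .var hY.lift) (.imp (.mem .var hA.lift)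
    (.forall hc.lift (.imp (.mem .var hX.lift.lift)
      (.imp (recog_edge hG.lift.lift Rec.var.lift .var) (.mem .var hY.lift.lift))))))

theorem recog_step {T : ∀ g, Set (Set (Fin (G g).n))} (hA : Rec e fun g => code (A g))
    (h𝒜 : Rec e fun g => code (𝒜 g)) (hT : Rec e fun g => code (T g))
    (hX : Rec e fun g => code (X g)) :
    Recog e fun g => Step (G g).arena.Edge (A g) (𝒜 g) (T g) (X g) := by
  have hc := rec_card_vertex hG
  have hcs := hc.card_set
  unfold Step
  refine .or (.forall hc (Recog.mem .var hX.lift).not) (.or (.and (.mem hX h𝒜)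
    (.and (recog_isArena hG hX) ?_)) ?_)
  · refine .forall hc (.imp (.mem .var hX.lift) (.exists hcs.lift (.and (.mem .var hT.lift.lift)
      (.and (recog_subset hG.lift.lift .var hX.lift.lift)
        (.and (Recog.mem Rec.var.lift .var).not ?_)))))
    exact .forall hc.lift.lift (.imp (.mem .var hX.lift.lift.lift) (.or (.mem .var Rec.var.lift)
      (recog_mem_attr hG.lift.lift.lift hA.lift.lift.lift hX.lift.lift.lift
        (rec_singleton hG.lift.lift.lift Rec.var.lift.lift) .var)))
  · refine .exists hcs (.and (.mem .var hT.lift) (.exists hcs.lift (.and (.mem .var hT.lift.lift)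
      (.and (recog_subset hG.lift.lift Rec.var.lift hX.lift.lift)
      (.and (recog_subset hG.lift.lift .var hX.lift.lift)
      (.and (recog_subset hG.lift.lift hX.lift.lift Rec.var.lift).not
      (.and (recog_subset hG.lift.lift hX.lift.lift .var).not
      (.and (recog_isTrap hG.lift.lift (rec_compl hG hA).lift.lift hX.lift.lift Rec.var.lift)
        ?_))))))))
    exact .forall hc.lift.lift (.imp (.mem .var hX.lift.lift.lift) (.or (.mem .var Rec.var.lift)
      (recog_mem_attr hG.lift.lift.lift hA.lift.lift.lift hX.lift.lift.lift
        Rec.var.lift.lift .var)))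

theorem recog_dom (hA : Rec e fun g => code (A g))
    (h𝒜 : Rec e fun g => code (𝒜 g)) (hX : Rec e fun g => code (X g)) :
    Recog e fun g => Dom (G g).arena.Edge (A g) (𝒜 g) (X g) := by
  have hcs := (rec_card_vertex hG).card_set
  unfold Dom
  exact .exists hcs.card_set (.and (.mem hX.lift .var) (.forall hcs.lift (.imp
    (.mem .var Rec.var.lift)
    (recog_step hG.lift.lift hA.lift.lift h𝒜.lift.lift Rec.var.lift .var))))

theorem recog_winsFrom (hA : Rec e fun g => code (A g))
    (h𝒜 : Rec e fun g => code (𝒜 g)) (hZ : Rec e fun g => code (Z g))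
    (hv : Rec e fun g => code (v g)) :
    Recog e fun g => WinsFrom (G g).arena.Edge (A g) (𝒜 g) (Z g) (v g) := by
  unfold WinsFrom
  exact .exists (rec_card_vertex hG).card_set (.and (.mem hv.lift .var)
    (.and (recog_subset hG.lift .var hZ.lift)
    (.and (recog_isTrap hG.lift (rec_compl hG hA).lift (rec_univ hG).lift .var)
      (recog_dom hG.lift hA.lift h𝒜.lift .var))))

/-! ### Recognizing equilibria -/

theorem recog_isRabinPair (hX : Rec e fun g => code (X g))
    (hY : Rec e fun g => code (Y g)) (hZ : Rec e fun g => code (Z g)) :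
    Recog e fun g => IsRabinPair (X g) (Y g) (Z g) := by
  have hc := rec_card_vertex hG
  unfold IsRabinPair
  exact .and (.forall hc (.imp (.mem .var hZ.lift) (Recog.mem .var hX.lift).not))
    (.exists hc (.and (.mem .var hZ.lift) (.mem .var hY.lift)))

omit hG in
/-- The value of a coded function is a digit of its code. -/
theorem rec_apply {n m : Γ → ℕ} {c : ∀ g, Fin (n g) → Fin (m g)} {v : ∀ g, Fin (n g)}
    (hm : Rec e m) (hc : Rec e fun g => code (c g)) (hv : Rec e fun g => code (v g)) :
    Rec e fun g => (c g (v g) : ℕ) := by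
  simp only [val_eq_code]
  exact (hc.comp₂ (hm.comp₂ hv primrec_pow) Primrec.nat_div).comp₂ hm Primrec.nat_mod

theorem recog_isFamily (C : ObjectiveClass) (h𝒜 : Rec e fun g => code (𝒜 g)) :
    Recog e fun g => C.IsFamily (𝒜 g) := by
  have hc := rec_card_vertex hG
  have hcs := hc.card_set
  cases C with
  | buchi =>
    unfold ObjectiveClass.IsFamily
    exact .exists hcs (.forall hcs.lift (.iff (.mem .var h𝒜.lift.lift)
      (.exists hc.lift.lift (.and (.mem .var Rec.var.lift) (.mem .var Rec.var.lift.lift)))))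
  | coBuchi =>
    unfold ObjectiveClass.IsFamily
    exact .exists hcs (.forall hcs.lift (.iff (.mem .var h𝒜.lift.lift) (Recog.not
      (.exists hc.lift.lift (.and (.mem .var Rec.var.lift) (.mem .var Rec.var.lift.lift))))))
  | parity =>
    refine Recog.congr ?_ fun g => exists_bounded_coloring
    have hb : Rec e fun g => 2 * card (Fin (G g).n) := (Rec.const 2).comp₂ hc Primrec.nat_mul
    have hcc : Rec e fun g => card (Fin (G g).n → Fin (2 * (G g).n)) := hb.comp₂ hc primrec_pow
    refine .exists hcc (.forall hcs.lift (.iff (.mem .var h𝒜.lift.lift) (.exists hc.lift.lift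
      (.and (.mem .var Rec.var.lift) (.and (.forall hc.lift.lift.lift (.imp
        (.mem .var Rec.var.lift.lift) ?_)) ?_)))))
    · exact .comp₂ (rec_apply hb.lift.lift.lift.lift Rec.var.lift.lift.lift .var)
        (rec_apply hb.lift.lift.lift.lift Rec.var.lift.lift.lift Rec.var.lift) Primrec.nat_le
    · exact .comp₂ ((rec_apply hb.lift.lift.lift Rec.var.lift.lift .var).comp₂ (Rec.const 2)
        Primrec.nat_mod) (Rec.const 0) Primrec.eq
  | rabin =>
    unfold ObjectiveClass.IsFamily
    exact .forall hcs (.imp (.mem .var h𝒜.lift) (.exists hcs.lift (.exists hcs.lift.lift (.and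
      (recog_isRabinPair hG.lift.lift.lift Rec.var.lift .var Rec.var.lift.lift)
      (.forall hcs.lift.lift.lift (.imp
        (recog_isRabinPair hG.lift.lift.lift.lift Rec.var.lift.lift Rec.var.lift .var)
        (.mem .var h𝒜.lift.lift.lift.lift)))))))
  | streett =>
    unfold ObjectiveClass.IsFamily
    exact .forall hcs (.imp (Recog.mem .var h𝒜.lift).not
      (.exists hcs.lift (.exists hcs.lift.lift (.and
      (recog_isRabinPair hG.lift.lift.lift Rec.var.lift .var Rec.var.lift.lift)
      (.forall hcs.lift.lift.lift (.imp
        (recog_isRabinPair hG.lift.lift.lift.lift Rec.var.lift.lift Rec.var.lift .var)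
        (Recog.mem .var h𝒜.lift.lift.lift.lift).not))))))
  | muller => exact .const True

theorem recog_isCandidate (knw : Knowledge) {p : ∀ g, Fin (G g).k}
    (hp : Rec e fun g => code (p g)) (h𝒜 : Rec e fun g => code (𝒜 g))
    (hX : Rec e fun g => code (X g)) :
    Recog e fun g => (G g).arena.IsCandidate (G g).winSets knw (p g) (𝒜 g) (X g) := by
  have hw := recog_winSets hG hp hX
  have hm := Recog.mem hX h𝒜
  have hplay := recog_winsFrom hG (rec_univ hG) h𝒜 (rec_univ hG) (rec_init hG)
  have hwin := recog_winsFrom hG (rec_owned hG hp) h𝒜 (rec_univ hG) (rec_init hG)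
  cases knw with
  | pw => exact (hm.and hw).or (hm.not.and hw.not)
  | gw => exact (hw.and hplay).or (hw.not.and hwin.not)
  | pg => exact hm.or (hm.not.and hwin.not)
  | pgw => exact (hm.and hw).or (hm.not.and (hw.not.and hwin.not))

theorem rec_tolerated (knw : Knowledge) (C : ObjectiveClass) {p : ∀ g, Fin (G g).k}
    (hp : Rec e fun g => code (p g)) (hX : Rec e fun g => code (X g)) :
    Rec e fun g => code ((G g).arena.tolerated (G g).winSets knw C (p g) (X g)) := by
  have hcs := (rec_card_vertex hG).card_set
  refine .set hcs (.and (.forall hcs.card_set.lift (.imp (recog_isFamily hG.lift.lift C .var)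
    (.imp ?_ ?_))) (.imp (recog_winSets hG.lift hp.lift .var)
      (recog_winSets hG.lift hp.lift hX.lift)))
  · exact recog_isCandidate hG.lift.lift knw hp.lift.lift .var Rec.var.lift
  · exact recog_isCandidate hG.lift.lift knw hp.lift.lift .var hX.lift.lift

end

theorem recog_exists_isOINE (knw : Knowledge) (C : ObjectiveClass) :
    Recog e fun g => ∃ S Z : Set (Fin (G g).n),
      WinsFrom (G g).arena.Edge Set.univ {S} Z (G g).arena.init ∧ ∀ p, ∀ v ∈ Z,
        WinsFrom (G g).arena.Edge {v | (G g).arena.owner v ≠ p}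
          ((G g).arena.tolerated (G g).winSets knw C p S) Set.univ v := by
  have hcs := (rec_card_vertex hG).card_set
  refine .exists hcs (.exists hcs.lift (.and (recog_winsFrom hG.lift.lift (rec_univ hG).lift.lift
    (rec_singleton_set hG.lift.lift Rec.var.lift) .var (rec_init hG).lift.lift)
    (.forall (rec_card_player hG).lift.lift (.forall (rec_card_vertex hG).lift.lift.lift
      (.imp (.mem .var Rec.var.lift.lift) (recog_winsFrom hG.lift.lift.lift.lift
        (rec_compl hG.lift.lift.lift.lift (rec_owned hG.lift.lift.lift.lift Rec.var.lift))
        (rec_tolerated hG.lift.lift.lift.lift knw C Rec.var.lift Rec.var.lift.lift.lift)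
        (rec_univ hG).lift.lift.lift.lift .var))))))

theorem recog_exists_forced_play :
    Recog e fun g => ∃ B : Set (Fin (G g).n), (G g).arena.init ∈ B ∧ ∀ v ∈ B, ∀ w,
      (G g).arena.Edge v w → w ∈ B ∧ ∀ w', (G g).arena.Edge v w' → w' = w := by
  have hc := rec_card_vertex hG
  exact .exists hc.card_set (.and (.mem (rec_init hG).lift .var) (.forall hc.lift (.imp
    (.mem .var Rec.var.lift) (.forall hc.lift.lift (.imp (recog_edge hG.lift.lift.lift
      Rec.var.lift .var) (.and (.mem .var Rec.var.lift.lift) (.forall hc.lift.lift.lift (.imp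
        (recog_edge hG.lift.lift.lift.lift Rec.var.lift.lift .var) (.eq .var Rec.var.lift)))))))))

end recognition

/-- A property that can be recognized from the codes of games is decidable; on inputs that are not
codes of games, the value of the algorithm does not matter. -/
theorem decidableForMullerGames_of_recog
    {Q : ∀ {k n : ℕ} (_ : GameArena (Fin k) (Fin n)), (Fin k → Set (ℕ → Fin n)) → Prop}
    {R : GameInstance → Prop} (hR : Recog GameInstance.code R)
    (hQ : ∀ I : GameInstance, I.arena.NonBlocking →
      (Q I.arena (fun p => {ρ ∈ I.arena.plays | infSet ρ ∈ I.winSets p}) ↔ R I)) :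
    DecidableForMullerGames Q := by
  classical
  obtain ⟨q, hq, h⟩ := hR
  refine ⟨fun c => decide (q c), (PrimrecPred.decide hq).to_comp, fun k n G F hG => ?_⟩
  rw [decide_eq_true_iff]
  let I : GameInstance := ⟨k, n, G, F⟩
  refine (h I).symm.trans ((hQ I hG).symm.trans (iff_of_eq ?_))
  congr 1
  funext p
  ext ρ
  simp [muller, I, GameInstance.winSets]

/-- The second part reads the case `pw` with arbitrary sets of infinite strings as candidates. -/
theorem theorem6 :
    (∀ (knw : Knowledge) (C : ObjectiveClass),
      DecidableForMullerGames fun G α =>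
        ∃ σ : G.Profile, GameArena.IsOINE knw (G.candidates knw C) α σ) ∧
    DecidableForMullerGames fun G α =>
      ∃ σ : G.Profile, GameArena.IsOINE .pw Set.univ α σ := by
  have hG : Rec GameInstance.code fun I => I.code := ⟨id, Primrec.id, fun _ => rfl⟩
  exact ⟨fun knw C => decidableForMullerGames_of_recog (recog_exists_isOINE hG knw C)
      fun I hI => GameArena.exists_isOINE_iff hI I.winSets knw C,
    decidableForMullerGames_of_recog (recog_exists_forced_play hG)
      fun I hI => GameArena.exists_isOINE_pw_univ_iff hI _⟩
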